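/- **Setting.** A tracial $\mathrm{W}^*$-algebra is a pair $\mathcal M=(M,\tau)$ with $M$ a $\mathrm{C}^*$-algebra that is a dual Banach space and $\tau$ a faithful, weak-$*$ continuous tracial state; $\|x\|_2=\tau(x^*x)^{1/2}$, and $D_r^{\mathcal M}$ ($r>0$) is the operator norm ball of radius $r$. Terms are built from variables $x_j$ ($j\in\mathbb N$) by the unital $*$-algebra operations (and evaluation of noncommutative polynomials). Formulas are built from $\operatorname{Re}\operatorname{tr}(t)$, $\operatorname{Im}\operatorname{tr}(t)$ and $d(s,t)=\|s-t\|_2$ ($s,t$ terms) by applying continuous functions $\mathbb R^k\to\mathbb R$ and the quantifiers $\inf_{x_j\in D_r}$, $\sup_{x_j\in D_r}$. A formula is quantifier-free if it uses no quantifier, and existential if it consists of finitely many (possibly no) $\inf$ quantifiers in front of a quantifier-free formula. The type $\operatorname{tp}^{\mathcal M}(\mathbf X)$ of $\mathbf X\in M^{\mathbb N}$ is the map $\phi\mapsto\phi^{\mathcal M}(\mathbf X)$ on formulas, and the existential type $\operatorname{tp}_\exists^{\mathcal M}(\mathbf X)$ is its restriction to existential formulas. Let $\mathbb S$ and $\mathbb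 S_\exists$ be the sets of all types, respectively existential types, of $\mathbb N$-tuples in tracial $\mathrm{W}^*$-algebras, let $\pi:\mathbb S\to\mathbb S_\exists$ be restriction, and for $\mathbf r\in(0,\infty)^{\mathbb N}$ let $\mathbb S_{\mathbf r}$ and $\mathbb S_{\exists,\mathbf r}$ be the subsets of those types realized by some $\mathbf X$ with $X_j\in D_{r_j}^{\mathcal M}$ for all $j$. **Topologies.** $\mathcal O\subseteq\mathbb S$ is open if for every $\mathbf r$ the set $\mathcal O\cap\mathbb S_{\mathbf r}$ is open in $\mathbb S_{\mathbf r}$ for pointwise convergence on formulas. $\mathcal O\subseteq\mathbb S_\exists$ is open if for every $\mathbf r$ and every $\mu\in\mathcal O\cap\mathbb S_{\exists,\mathbf r}$ there are existential formulas $\phi_1,\dots,\phi_k$ and $\epsilon_1,\dots,\epsilon_k>0$ with $\{\nu\in\mathbb S_{\exists,\mathbf r}:\nu(\phi_i)<\mu(\phi_i)+\epsilon_i,\ i=1,\dots,k\}\subseteq\mathcal O$. **Entropy.** Fix a non-principal ultrafilter $\mathcal U$ on $\mathbb N$, and give $M_n(\mathbb C)$ the operator norm and the normalized trace. For $\mathcal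 K\subseteq\mathbb S$ let $\Gamma^{(n)}_{\mathbf r}(\mathcal K)$ be the set of $\mathbf X\in M_n(\mathbb C)^{\mathbb N}$ with $\|X_j\|\le r_j$ for all $j$ and $\operatorname{tp}^{M_n(\mathbb C)}(\mathbf X)\in\mathcal K$. For $F\subseteq\mathbb N$ finite and $\epsilon>0$ let $K^{\mathrm{orb}}_{F,\epsilon}(\Omega)$ be the least cardinality of a set $\Omega'\subseteq M_n(\mathbb C)^{\mathbb N}$ such that every $\mathbf Y\in\Omega$ satisfies $\|Y_i-VX_iV^*\|_2<\epsilon$ for all $i\in F$, for some unitary $V$ and some $\mathbf X\in\Omega'$. With values in $[-\infty,\infty]$ and $\log 0=-\infty$, set $$\operatorname{Ent}^{\mathcal U}(\mathcal K)=\sup_{\mathbf r\in(0,\infty)^{\mathbb N}}\ \sup_{F\subseteq\mathbb N\text{ finite},\ \epsilon>0}\ \inf_{\mathcal O\supseteq\mathcal K\text{ open}}\ \lim_{n\to\mathcal U}\frac1{n^2}\log K^{\mathrm{orb}}_{F,\epsilon}\bigl(\Gamma^{(n)}_{\mathbf r}(\mathcal O)\bigr).$$ For $\mathcal K\subseteq\mathbb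 S_\exists$, define $\operatorname{Ent}^{\mathcal U}_\exists(\mathcal K)$ in the same way, using existential types and open sets $\mathcal O\subseteq\mathbb S_\exists$. Write $\operatorname{Ent}^{\mathcal U}(\nu)=\operatorname{Ent}^{\mathcal U}(\{\nu\})$ and $\operatorname{Ent}^{\mathcal U}_\exists(\mu)=\operatorname{Ent}^{\mathcal U}_\exists(\{\mu\})$. **Statement.** Let $\mu\in\mathbb S_\exists$ and let $\mathcal K_\mu=\{\nu\in\mathbb S_\exists:\nu(\phi)\le\mu(\phi)\text{ for all existential formulas }\phi\}$ be the set of its extensions. Then $$\operatorname{Ent}^{\mathcal U}_\exists(\mu)=\operatorname{Ent}^{\mathcal U}\bigl(\pi^{-1}(\mathcal K_\mu)\bigr)=\sup_{\nu\in\pi^{-1}(\mathcal K_\mu)}\operatorname{Ent}^{\mathcal U}(\nu).$$ -/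

import Mathlib

universe u

namespace TracialEntropy

/-! ### The language of tracial W*-algebras -/

/-- Terms of the language of tracial W*-algebras, with variables `x_j`, `j ∈ ℕ`. Besides the
`*`-algebra operations there is a symbol for every noncommutative polynomial in `d` variables. -/
inductive Term : Type
  | var (j : ℕ) : Term
  | zero : Term
  | one : Term
  | add (s t : Term) : Term
  | mul (s t : Term) : Term
  | star (t : Term) : Term
  | smul (c : ℂ) (t : Term) : Term
  | poly (d : ℕ) (p : FreeAlgebra ℂ (Fin d)) (t : Fin d → Term) : Term

/-- Formulas: the relation symbols `Re tr`, `Im tr` and the metric symbol applied to terms,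
continuous connectives `F : ℝⁿ → ℝ`, and `inf` / `sup` of the variable `x_j` over the domain of
quantification `D_r`, `r > 0`. -/
inductive Formula : Type
  | reTr (t : Term) : Formula
  | imTr (t : Term) : Formula
  | dist (s t : Term) : Formula
  | conn (n : ℕ) (F : C(Fin n → ℝ, ℝ)) (φ : Fin n → Formula) : Formula
  | inf (r : Set.Ioi (0 : ℝ)) (j : ℕ) (φ : Formula) : Formula
  | sup (r : Set.Ioi (0 : ℝ)) (j : ℕ) (φ : Formula) : Formula

/-- Quantifier-free formulas. -/
inductive Formula.IsQuantifierFree : Formula → Prop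
  | reTr (t : Term) : IsQuantifierFree (.reTr t)
  | imTr (t : Term) : IsQuantifierFree (.imTr t)
  | dist (s t : Term) : IsQuantifierFree (.dist s t)
  | conn (n : ℕ) (F : C(Fin n → ℝ, ℝ)) (φ : Fin n → Formula)
      (h : ∀ i, IsQuantifierFree (φ i)) : IsQuantifierFree (.conn n F φ)

/-- Existential formulas: finitely many (possibly no) `inf` quantifiers in front of a
quantifier-free formula. -/
inductive Formula.IsExistential : Formula → Prop
  | qf (φ : Formula) (h : φ.IsQuantifierFree) : IsExistential φ
  | inf (r : Set.Ioi (0 : ℝ)) (j : ℕ) (φ : Formula) (h : IsExistential φ) :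
      IsExistential (.inf r j φ)

/-- The existential formulas in the variables `x_j`, `j ∈ ℕ`. -/
abbrev ExistentialFormula : Type := {φ : Formula // φ.IsExistential}

/-! ### Tracial W*-algebras and the interpretation of formulas -/

section Interpretation

variable {M : Type u} [CStarAlgebra M]

/-- The pair `(M, τ)` is a tracial W*-algebra: the C*-algebra `M` is (isometrically) the dual of
a Banach space `X`, and `τ` is a faithful tracial state, continuous for the weak-* topology. As in
Mathlib's `WStarAlgebra`, the identification of `M` with the dual is taken conjugate-linear, which
amounts to replacing `X` by its conjugate space. -/
structure IsTracialWStar (τ : M →ₗ[ℂ] ℂ) : Prop where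
  nonneg_re : ∀ x : M, 0 ≤ (τ (star x * x)).re
  nonneg_im : ∀ x : M, (τ (star x * x)).im = 0
  unital : τ 1 = 1
  tracial : ∀ x y : M, τ (x * y) = τ (y * x)
  faithful : ∀ x : M, τ (star x * x) = 0 → x = 0
  weakStar : ∃ (X : Type u) (_ : NormedAddCommGroup X) (_ : NormedSpace ℂ X)
    (_ : CompleteSpace X) (e : StrongDual ℂ X ≃ₗᵢ⋆[ℂ] M),
    Continuous fun f : WeakDual ℂ X => τ (e (WeakDual.toStrongDual f))

theorem IsTracialWStar.wStarAlgebra {τ : M →ₗ[ℂ] ℂ} (h : IsTracialWStar τ) :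
    WStarAlgebra M := by
  obtain ⟨X, i₁, i₂, i₃, e, -⟩ := h.weakStar
  exact ⟨⟨X, i₁, i₂, i₃, ⟨e⟩⟩⟩

/-- The norm `‖x‖₂ = τ(x* x)^{1/2}`. -/
noncomputable def norm2 (τ : M →ₗ[ℂ] ℂ) (x : M) : ℝ :=
  Real.sqrt (τ (star x * x)).re

/-- Interpretation of a term at an assignment `X` of the variables. -/
noncomputable def Term.eval (X : ℕ → M) : Term → M
  | .var j => X j
  | .zero => 0
  | .one => 1
  | .add s t => s.eval X + t.eval X
  | .mul s t => s.eval X * t.eval X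
  | .star t => Star.star (t.eval X)
  | .smul c t => c • t.eval X
  | .poly _ p t => FreeAlgebra.lift ℂ (fun i => (t i).eval X) p

/-- Interpretation of a formula at an assignment `X` of the variables; the domain `D_r` is
interpreted as the operator norm ball of radius `r`. -/
noncomputable def Formula.eval (τ : M →ₗ[ℂ] ℂ) : Formula → (ℕ → M) → ℝ
  | .reTr t, X => (τ (t.eval X)).re
  | .imTr t, X => (τ (t.eval X)).im
  | .dist s t, X => norm2 τ (s.eval X - t.eval X)
  | .conn _ F φ, X => F fun i => (φ i).eval τ X
  | .inf r j φ, X => ⨅ Y : {Y : M // ‖Y‖ ≤ r}, φ.eval τ (Function.update X j Y)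
  | .sup r j φ, X => ⨆ Y : {Y : M // ‖Y‖ ≤ r}, φ.eval τ (Function.update X j Y)

/-- The type of `X` in `(M, τ)`. -/
noncomputable def tp (τ : M →ₗ[ℂ] ℂ) (X : ℕ → M) : Formula → ℝ :=
  fun φ => φ.eval τ X

/-- The existential type of `X` in `(M, τ)`. -/
noncomputable def tpExists (τ : M →ₗ[ℂ] ℂ) (X : ℕ → M) : ExistentialFormula → ℝ :=
  fun φ => φ.1.eval τ X

end Interpretation

/-- Tuples of radii, i.e. tuples `(D_{r_j})_j` of domains of quantification. -/
abbrev Radii : Type := ℕ → Set.Ioi (0 : ℝ)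

/-! ### The space of types -/

/-- The space of types of `ℕ`-tuples in tracial W*-algebras. -/
@[ext]
structure TypeSpace : Type where
  toFun : Formula → ℝ
  realized : ∃ (M : Type u) (_ : CStarAlgebra M) (τ : M →ₗ[ℂ] ℂ) (X : ℕ → M),
    IsTracialWStar τ ∧ tp τ X = toFun

/-- The set of types of tuples `X` with `‖X_j‖ ≤ r_j` for all `j`. -/
def TypeSpace.bounded (r : Radii) : Set TypeSpace.{u} :=
  {p | ∃ (M : Type u) (_ : CStarAlgebra M) (τ : M →ₗ[ℂ] ℂ) (X : ℕ → M),
    IsTracialWStar τ ∧ (∀ j, ‖X j‖ ≤ r j) ∧ tp τ X = p.toFun}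

/-- The logic topology: a set is open iff its intersection with each `TypeSpace.bounded r` is
open there for the topology of pointwise convergence on formulas. -/
instance : TopologicalSpace TypeSpace.{u} :=
  ⨆ r : Radii, TopologicalSpace.coinduced
    (Subtype.val : TypeSpace.bounded.{u} r → TypeSpace.{u})
    (TopologicalSpace.induced (fun p => p.1.toFun) (inferInstance : TopologicalSpace (Formula → ℝ)))

theorem TypeSpace.isOpen_iff (O : Set TypeSpace.{u}) :
    IsOpen O ↔ ∀ r : Radii, ∃ V : Set (Formula → ℝ), IsOpen V ∧
      ∀ p ∈ TypeSpace.bounded.{u} r, p ∈ O ↔ p.toFun ∈ V := by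
  refine isOpen_iSup_iff.trans (forall_congr' fun r => ?_)
  rw [isOpen_coinduced, isOpen_induced_iff]
  refine exists_congr fun V => and_congr_right fun _ => ?_
  rw [Set.ext_iff]
  exact ⟨fun h p hp => (h ⟨p, hp⟩).symm, fun h p => (h p.1 p.2).symm⟩

/-! ### The space of existential types -/

/-- The space of existential types of `ℕ`-tuples in tracial W*-algebras. -/
@[ext]
structure ExistentialTypeSpace : Type where
  toFun : ExistentialFormula → ℝ
  realized : ∃ (M : Type u) (_ : CStarAlgebra M) (τ : M →ₗ[ℂ] ℂ) (X : ℕ → M),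
    IsTracialWStar τ ∧ tpExists τ X = toFun

/-- The set of existential types of tuples `X` with `‖X_j‖ ≤ r_j` for all `j`. -/
def ExistentialTypeSpace.bounded (r : Radii) : Set ExistentialTypeSpace.{u} :=
  {p | ∃ (M : Type u) (_ : CStarAlgebra M) (τ : M →ₗ[ℂ] ℂ) (X : ℕ → M),
    IsTracialWStar τ ∧ (∀ j, ‖X j‖ ≤ r j) ∧ tpExists τ X = p.toFun}

/-- The topology on existential types: a set `O` is open iff, for each tuple of radii `r`, every
`μ ∈ O` in the set of existential types bounded by `r` has a neighbourhood of the form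
`{ν : ν(φ) < μ(φ) + ε_φ for φ in a finite set}` whose `r`-bounded part lies in `O`. -/
instance : TopologicalSpace ExistentialTypeSpace.{u} where
  IsOpen O := ∀ r : Radii, ∀ μ ∈ O, μ ∈ ExistentialTypeSpace.bounded.{u} r →
    ∃ (s : Finset ExistentialFormula) (ε : ExistentialFormula → ℝ), (∀ φ ∈ s, 0 < ε φ) ∧
      ∀ ν ∈ ExistentialTypeSpace.bounded.{u} r,
        (∀ φ ∈ s, ν.toFun φ < μ.toFun φ + ε φ) → ν ∈ O
  isOpen_univ := fun _ _ _ _ => ⟨∅, fun _ => 1, by simp, fun _ _ _ => Set.mem_univ _⟩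
  isOpen_inter := by
    classical
    intro O₁ O₂ h₁ h₂ r μ hμ hr
    obtain ⟨s₁, ε₁, p₁, H₁⟩ := h₁ r μ hμ.1 hr
    obtain ⟨s₂, ε₂, p₂, H₂⟩ := h₂ r μ hμ.2 hr
    refine ⟨s₁ ∪ s₂, fun φ => min (if φ ∈ s₁ then ε₁ φ else 1) (if φ ∈ s₂ then ε₂ φ else 1),
      fun φ _ => ?_, fun ν hν H => ⟨H₁ ν hν fun φ hφ => ?_, H₂ ν hν fun φ hφ => ?_⟩⟩
    · refine lt_min ?_ ?_
      · split_ifs with h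
        exacts [p₁ φ h, one_pos]
      · split_ifs with h
        exacts [p₂ φ h, one_pos]
    · refine (H φ (Finset.mem_union_left _ hφ)).trans_le ?_
      have := min_le_left (if φ ∈ s₁ then ε₁ φ else 1) (if φ ∈ s₂ then ε₂ φ else 1)
      rw [if_pos hφ] at this
      dsimp only
      rw [if_pos hφ]
      linarith
    · refine (H φ (Finset.mem_union_right _ hφ)).trans_le ?_
      have := min_le_right (if φ ∈ s₁ then ε₁ φ else 1) (if φ ∈ s₂ then ε₂ φ else 1)
      rw [if_pos hφ] at this
      dsimp only
      rw [if_pos hφ]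
      linarith
  isOpen_sUnion := by
    intro S hS r μ ⟨O, hO, hμ⟩ hr
    obtain ⟨s, ε, p, H⟩ := hS O hO r μ hμ hr
    exact ⟨s, ε, p, fun ν hν h => ⟨O, hO, H ν hν h⟩⟩

/-- The canonical map `π` restricting a type to existential formulas. -/
def restrict (p : TypeSpace.{u}) : ExistentialTypeSpace.{u} where
  toFun := fun φ => p.toFun φ.1
  realized := by
    obtain ⟨M, i, τ, X, h, hX⟩ := p.realized
    exact ⟨M, i, τ, X, h, by rw [← hX]; rfl⟩

/-- The set `K_μ` of existential types extending `μ`. -/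
def extensions (μ : ExistentialTypeSpace.{u}) : Set ExistentialTypeSpace.{u} :=
  {ν | ∀ φ, ν.toFun φ ≤ μ.toFun φ}

/-! ### Microstates and orbital covering numbers

`M_n(ℂ)` carries the operator norm and the normalized trace. -/

section Microstates

open scoped Matrix.Norms.L2Operator

/-- The normalized trace `tr_n = (1/n) Tr` on `M_n(ℂ)`. -/
noncomputable def trN (n : ℕ) : Matrix (Fin n) (Fin n) ℂ →ₗ[ℂ] ℂ :=
  (n : ℂ)⁻¹ • Matrix.traceLinearMap (Fin n) ℂ ℂ

/-- The microstate space `Γ_r^{(n)}(K)` of a set `K` of types. -/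
def microstates (r : Radii) (n : ℕ) (K : Set TypeSpace.{u}) :
    Set (ℕ → Matrix (Fin n) (Fin n) ℂ) :=
  {X | (∀ j, ‖X j‖ ≤ r j) ∧ ∃ p ∈ K, p.toFun = tp (trN n) X}

/-- The microstate space `Γ_r^{(n)}(K)` of a set `K` of existential types. -/
def microstatesExists (r : Radii) (n : ℕ) (K : Set ExistentialTypeSpace.{u}) :
    Set (ℕ → Matrix (Fin n) (Fin n) ℂ) :=
  {X | (∀ j, ‖X j‖ ≤ r j) ∧ ∃ p ∈ K, p.toFun = tpExists (trN n) X}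

/-- The orbital `(F, ε)`-neighbourhood of `Ω`. -/
def orbNhd {n : ℕ} (F : Finset ℕ) (ε : ℝ) (Ω : Set (ℕ → Matrix (Fin n) (Fin n) ℂ)) :
    Set (ℕ → Matrix (Fin n) (Fin n) ℂ) :=
  {Y | ∃ U ∈ Matrix.unitaryGroup (Fin n) ℂ, ∃ X ∈ Ω,
    ∀ i ∈ F, norm2 (trN n) (Y i - U * X i * star U) < ε}

/-- The orbital covering number: the least cardinality of a set that orbitally
`(F, ε)`-covers `Ω`. -/
noncomputable def orbCov {n : ℕ} (F : Finset ℕ) (ε : ℝ)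
    (Ω : Set (ℕ → Matrix (Fin n) (Fin n) ℂ)) : ℕ∞ :=
  ⨅ (Ω' : Set (ℕ → Matrix (Fin n) (Fin n) ℂ)) (_ : Ω ⊆ orbNhd F ε Ω'), Ω'.encard

/-- `lim_{n → U} (1/n²) log K^{orb}_{F,ε}(Γ_n)` in `[-∞, ∞]`, with `log 0 = -∞`. -/
noncomputable def covRate (U : Ultrafilter ℕ) (F : Finset ℕ) (ε : ℝ)
    (Γ : (n : ℕ) → Set (ℕ → Matrix (Fin n) (Fin n) ℂ)) : EReal :=
  Filter.limUnder (U : Filter ℕ) fun n =>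
    ((1 / (n : ℝ) ^ 2 : ℝ) : EReal) * ENNReal.log (orbCov F ε (Γ n) : ENNReal)

end Microstates

/-! ### Covering entropy -/

/-- `Ent_{r,F,ε}^U(K)` for a set `K` of types. -/
noncomputable def entAt (U : Ultrafilter ℕ) (r : Radii) (F : Finset ℕ) (ε : ℝ)
    (K : Set TypeSpace.{u}) : EReal :=
  ⨅ (O : Set TypeSpace.{u}) (_ : IsOpen O) (_ : K ⊆ O),
    covRate U F ε fun n => microstates r n O

/-- The covering entropy `Ent^U(K)` of a set `K` of types. -/
noncomputable def ent (U : Ultrafilter ℕ) (K : Set TypeSpace.{u}) : EReal :=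
  ⨆ (r : Radii) (F : Finset ℕ) (ε : ℝ) (_ : 0 < ε), entAt U r F ε K

/-- `Ent_{∃,r,F,ε}^U(K)` for a set `K` of existential types. -/
noncomputable def entExistsAt (U : Ultrafilter ℕ) (r : Radii) (F : Finset ℕ) (ε : ℝ)
    (K : Set ExistentialTypeSpace.{u}) : EReal :=
  ⨅ (O : Set ExistentialTypeSpace.{u}) (_ : IsOpen O) (_ : K ⊆ O),
    covRate U F ε fun n => microstatesExists r n O

/-- The existential covering entropy `Ent_∃^U(K)` of a set `K` of existential types. -/
noncomputable def entExists (U : Ultrafilter ℕ) (K : Set ExistentialTypeSpace.{u}) : EReal :=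
  ⨆ (r : Radii) (F : Finset ℕ) (ε : ℝ) (_ : 0 < ε), entExistsAt U r F ε K

end TracialEntropy

-- Two facts carry the theorem. The topology on existential types tests membership only by strict
-- upper bounds `ν(φ) < μ(φ) + ε`, so an open set containing `μ` contains every extension of `μ`
-- (`extensions_subset`). The space of `r`-bounded types is compact (`isCompact_boundedTypes`).
--
-- Since restriction is continuous, preimages of neighbourhoods of `μ` compete in the infimum for
-- `Ent(π⁻¹(K_μ))`, giving `≥` in the first equality. Conversely, let `O` be open around `π⁻¹(K_μ)`.
-- Each bounded type outside `O` exceeds `μ` strictly at some existential formula; by compactness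
-- finitely many formulas suffice, and they define a neighbourhood of `μ` whose `r`-bounded preimage
-- lies in `O`. In the second equality, the bounded part of `π⁻¹(K_μ)` is covered by finitely many
-- open sets of nearly optimal entropy; covering numbers are subadditive, and the factor 2 per union
-- disappears in `(1/n²) log`.
--
-- Compactness comes from tracial ultraproducts and Łoś's theorem. Most of the work is showing that
-- the ultraproduct is a W*-algebra: its unit ball is complete in the 2-norm, and a Hahn–Banach
-- argument turns this into a predual.

universe v

namespace TracialEntropy

/-! ### Preduals from an embedding into a Hilbert space -/

section

open scoped InnerProductSpace ComplexConjugate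

/-- A Banach space `X` pairing isometrically with a normed space `E`, in which a Hilbert space
containing `E` (with closed unit ball) maps densely, is a predual of `E`. -/
theorem exists_dual_equiv {E : Type*} {H : Type*} [NormedAddCommGroup E] [NormedSpace ℂ E]
    [NormedAddCommGroup H] [InnerProductSpace ℂ H] [CompleteSpace H] (j : E →L[ℂ] H)
    (hj : Function.Injective j) (hc : IsClosed (j '' Metric.closedBall 0 1))
    {X : Type*} [NormedAddCommGroup X] [NormedSpace ℂ X] (ι : X →ₗᵢ[ℂ] (E →L⋆[ℂ] ℂ))
    (T : H →ₗ[ℂ] X) (hT : ∀ h m, ι (T h) m = ⟪j m, h⟫_ℂ) (hd : DenseRange T) :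
    ∃ e : StrongDual ℂ X ≃ₗᵢ⋆[ℂ] E,
      ∀ h : H, Continuous fun f : WeakDual ℂ X => ⟪h, j (e (WeakDual.toStrongDual f))⟫_ℂ := by
  let ev₀ : E → X →ₗ[ℂ] ℂ := fun m =>
    { toFun := fun g => ι g m
      map_add' := fun _ _ => by simp
      map_smul' := fun _ _ => by simp }
  have hev₀ : ∀ m g, ‖ev₀ m g‖ ≤ ‖m‖ * ‖g‖ := fun m g => by
    rw [mul_comm, ← ι.norm_map]; exact (ι g).le_opNorm m
  let ev : E →ₗ⋆[ℂ] StrongDual ℂ X :=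
    { toFun := fun m => (ev₀ m).mkContinuous ‖m‖ (hev₀ m)
      map_add' := fun a b => by ext g; exact map_add (ι g) a b
      map_smul' := fun a b => by ext g; exact map_smulₛₗ (ι g) a b }
  have hev : ∀ m g, ev m g = ι g m := fun m g => rfl
  have hev_le : ∀ m, ‖ev m‖ ≤ ‖m‖ := fun m => LinearMap.mkContinuous_norm_le _ (norm_nonneg _) (hev₀ m)
  have hev_inj : ∀ m m', ev m = ev m' → m = m' := by
    intro m m' h
    apply hj
    refine ext_inner_right ℂ fun h' => ?_
    have := congrArg (fun f => f (T h')) h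
    simpa [hev, hT] using this
  -- Riesz represents `f ∘ T` by a vector `ξ`. If `ξ` missed the closed convex set `j(ball)`, a
  -- separating vector `h` would satisfy `‖T h‖ ≤ u < Re ⟪h, ξ⟫ ≤ |f (T h)| ≤ ‖T h‖`.
  have key : ∀ f : StrongDual ℂ X, ‖f‖ ≤ 1 → ∃ m, ‖m‖ ≤ 1 ∧ ev m = f := by
    intro f hf
    let F : StrongDual ℂ H := LinearMap.mkContinuous
      { toFun := fun h => f (T h)
        map_add' := fun a b => by
          simp
        map_smul' := fun a b => by
          simp } ‖j‖ (fun h => by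
          calc ‖f (T h)‖ ≤ ‖f‖ * ‖T h‖ := f.le_opNorm _
            _ ≤ 1 * ‖T h‖ := by gcongr
            _ = ‖T h‖ := one_mul _
            _ ≤ ‖j‖ * ‖h‖ := by
              rw [← ι.norm_map]
              refine ContinuousLinearMap.opNorm_le_bound _ (by positivity) fun m => ?_
              rw [hT]
              calc ‖⟪j m, h⟫_ℂ‖ ≤ ‖j m‖ * ‖h‖ := norm_inner_le_norm _ _
                _ ≤ ‖j‖ * ‖m‖ * ‖h‖ := by gcongr; exact j.le_opNorm m
                _ = _ := by ring)
    set ξ := (InnerProductSpace.toDual ℂ H).symm F with hξ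
    have hξF : ∀ h, ⟪ξ, h⟫_ℂ = f (T h) := fun h => by
      rw [hξ, InnerProductSpace.toDual_symm_apply]; rfl
    have hmem : ξ ∈ j '' Metric.closedBall 0 1 := by
      by_contra hnot
      obtain ⟨φ, u, hφ, hu⟩ := RCLike.geometric_hahn_banach_closed_point (𝕜 := ℂ)
        (((convex_closedBall (0 : E) 1).linear_image (j.restrictScalars ℝ).toLinearMap)) hc hnot
      set h := (InnerProductSpace.toDual ℂ H).symm φ with hh
      have hφh : ∀ x, φ x = ⟪h, x⟫_ℂ := fun x => by
        rw [hh, InnerProductSpace.toDual_symm_apply]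
      have hu0 : 0 < u := by
        simpa using hφ 0 ⟨0, by simp⟩
      have hTh : ‖T h‖ ≤ u := by
        rw [← ι.norm_map]
        refine ContinuousLinearMap.opNorm_le_bound _ hu0.le fun m => ?_
        rw [hT, ← norm_inner_symm, ← hφh]
        by_cases hz : φ (j m) = 0
        · rw [hz, norm_zero]; positivity
        have hm : m ≠ 0 := by rintro rfl; simp at hz
        have hm' : 0 < ‖m‖ := norm_pos_iff.2 hm
        have hz' : 0 < ‖φ (j m)‖ := norm_pos_iff.2 hz
        -- The scalar normalizes `m` to norm one and rotates `φ (j m)` onto the positive axis, so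
        -- the bound on the real part controls the modulus.
        have h1 := hφ (j (((conj (φ (j m)) / (‖φ (j m)‖ * ‖m‖ : ℝ) : ℂ)) • m)) ⟨_, by
          rw [mem_closedBall_zero_iff, norm_smul, norm_div, RCLike.norm_conj, Complex.norm_real,
            Real.norm_of_nonneg (by positivity)]
          field_simp
          exact le_rfl, rfl⟩
        have h2 : φ (j (((conj (φ (j m)) / (‖φ (j m)‖ * ‖m‖ : ℝ) : ℂ)) • m))
            = ((‖φ (j m)‖ / ‖m‖ : ℝ) : ℂ) := by
          rw [map_smul, map_smul, smul_eq_mul, div_mul_eq_mul_div, RCLike.conj_mul]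
          push_cast
          have : (‖φ (j m)‖ : ℂ) ≠ 0 := by exact_mod_cast hz'.ne'
          have : (‖m‖ : ℂ) ≠ 0 := by exact_mod_cast hm'.ne'
          simp only [Complex.coe_algebraMap]
          field_simp
        rw [h2] at h1
        have h3 : ‖φ (j m)‖ / ‖m‖ < u := by simpa using h1
        exact ((div_lt_iff₀ hm').1 h3).le
      have h4 : u < ‖T h‖ := by
        calc u < RCLike.re (φ ξ) := hu
          _ = RCLike.re ⟪h, ξ⟫_ℂ := by rw [hφh]
          _ ≤ ‖⟪h, ξ⟫_ℂ‖ := RCLike.re_le_norm _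
          _ = ‖f (T h)‖ := by rw [norm_inner_symm, hξF]
          _ ≤ ‖f‖ * ‖T h‖ := f.le_opNorm _
          _ ≤ 1 * ‖T h‖ := by gcongr
          _ = ‖T h‖ := one_mul _
      exact absurd hTh (not_le.2 h4)
    obtain ⟨m, hm, hmξ⟩ := hmem
    refine ⟨m, by simpa using hm, ?_⟩
    refine ContinuousLinearMap.ext fun g => ?_
    refine congrFun (hd.equalizer (ev m).continuous f.continuous (funext fun h => ?_)) g
    simp only [Function.comp_apply]
    rw [hev, ← hξF, hT, hmξ]
  have hnorm : ∀ m, ‖ev m‖ = ‖m‖ := by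
    intro m
    refine le_antisymm (hev_le m) ?_
    by_cases h0 : ev m = 0
    · have : m = 0 := hev_inj m 0 (by rw [h0, map_zero])
      simp [this]
    have hp : 0 < ‖ev m‖ := norm_pos_iff.2 h0
    -- The normalized functional is evaluation at some `m'` in the unit ball; injectivity forces `m
    -- = ‖ev m‖ • m'`, hence `‖m‖ ≤ ‖ev m‖`.
    obtain ⟨m', hm', he⟩ := key (((‖ev m‖⁻¹ : ℝ) : ℂ) • ev m) (by
      rw [norm_smul, Complex.norm_real, norm_inv, norm_norm, inv_mul_cancel₀ hp.ne'])
    have : m = ((‖ev m‖ : ℝ) : ℂ) • m' := hev_inj _ _ (by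
      rw [map_smulₛₗ, he, smul_smul]
      have : (‖ev m‖ : ℂ) ≠ 0 := by exact_mod_cast hp.ne'
      simp [this])
    calc ‖m‖ = ‖ev m‖ * ‖m'‖ := by
          conv_lhs => rw [this]
          rw [norm_smul, Complex.norm_real, norm_norm]
      _ ≤ ‖ev m‖ * 1 := by gcongr
      _ = _ := mul_one _
  let evi : E →ₗᵢ⋆[ℂ] StrongDual ℂ X := ⟨ev, hnorm⟩
  have hsurj : Function.Surjective evi := by
    intro f
    by_cases h0 : f = 0
    · exact ⟨0, by rw [map_zero, h0]⟩
    have hp : 0 < ‖f‖ := norm_pos_iff.2 h0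
    obtain ⟨m, -, he⟩ := key (((‖f‖⁻¹ : ℝ) : ℂ) • f) (by
      rw [norm_smul, Complex.norm_real, norm_inv, norm_norm, inv_mul_cancel₀ hp.ne'])
    refine ⟨((‖f‖ : ℝ) : ℂ) • m, ?_⟩
    change ev _ = f
    rw [map_smulₛₗ, he, smul_smul]
    have : (‖f‖ : ℂ) ≠ 0 := by exact_mod_cast hp.ne'
    simp [this]
  let e := (LinearIsometryEquiv.ofSurjective evi hsurj).symm
  refine ⟨e, fun h => ?_⟩
  have : (fun f : WeakDual ℂ X => ⟪h, j (e (WeakDual.toStrongDual f))⟫_ℂ)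
      = fun f : WeakDual ℂ X => conj (f (T h)) := by
    funext f
    have h1 : ev (e (WeakDual.toStrongDual f)) = WeakDual.toStrongDual f :=
      (LinearIsometryEquiv.ofSurjective evi hsurj).apply_symm_apply _
    have h2 : f (T h) = ev (e (WeakDual.toStrongDual f)) (T h) := by rw [h1]; rfl
    rw [h2, hev, hT, inner_conj_symm]
  rw [this]
  exact Complex.continuous_conj.comp (WeakDual.eval_continuous _)

/-- If a normed space `E` embeds in a Hilbert space in such a way that the unit ball has closed
image, then `E` is isometrically a dual space, and the functionals coming from the Hilbert space
are weak-* continuous. -/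
theorem exists_predual {E : Type u} {H : Type v} [NormedAddCommGroup E] [NormedSpace ℂ E]
    [NormedAddCommGroup H] [InnerProductSpace ℂ H] [CompleteSpace H] (j : E →L[ℂ] H)
    (hj : Function.Injective j) (hc : IsClosed (j '' Metric.closedBall 0 1)) :
    ∃ (X : Type u) (_ : NormedAddCommGroup X) (_ : NormedSpace ℂ X) (_ : CompleteSpace X)
      (e : StrongDual ℂ X ≃ₗᵢ⋆[ℂ] E),
      ∀ h : H, Continuous fun f : WeakDual ℂ X => ⟪h, j (e (WeakDual.toStrongDual f))⟫_ℂ := by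
  let T : H →ₗ[ℂ] (E →L⋆[ℂ] ℂ) :=
    { toFun := fun h => (innerSLFlip ℂ h).comp j
      map_add' := fun a b => by ext m; simp
      map_smul' := fun a b => by ext m; simp }
  -- Taking the closure among functionals on `E` places the predual in the universe of `E`, whatever
  -- the universe of `H`.
  let X : Submodule ℂ (E →L⋆[ℂ] ℂ) := (LinearMap.range T).topologicalClosure
  have hTX : ∀ h, T h ∈ X := fun h => Submodule.le_topologicalClosure _ ⟨h, rfl⟩
  have : CompleteSpace X :=
    (Submodule.isClosed_topologicalClosure (LinearMap.range T)).completeSpace_coe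
  refine ⟨X, inferInstance, inferInstance, inferInstance,
    exists_dual_equiv j hj hc X.subtypeₗᵢ (T.codRestrict X hTX) (fun h m => rfl) fun x => ?_⟩
  rw [closure_subtype]
  refine closure_mono ?_ x.2
  rintro _ ⟨h, rfl⟩
  exact ⟨⟨T h, hTX h⟩, ⟨h, rfl⟩, rfl⟩

end

/-! ### Lifting and closed range for `*`-homomorphisms -/

section

open scoped CStarAlgebra in
/-- An element in the range of a `*`-homomorphism of C*-algebras lifts without increasing its
norm bound. -/
theorem exists_lift_norm_le {A B : Type*} [CStarAlgebra A] [CStarAlgebra B] (π : A →⋆ₐ[ℂ] B)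
    {r : ℝ} (hr : 0 < r) (a : A) (ha : ‖π a‖ ≤ r) : ∃ a', π a' = π a ∧ ‖a'‖ ≤ r := by
  -- `f = 1` for `t ≤ r²`, where the spectrum of `π b` lies, so `π (f(b)) = 1`; and `t f(t)² ≤ r²`
  -- for `t ≥ 0`, so `‖a f(b)‖ ≤ r`.
  let f : ℝ → ℝ := fun t => r / √(max (r ^ 2) t)
  have hpos : ∀ t, 0 < √(max (r ^ 2) t) := fun t => Real.sqrt_pos.2 (lt_max_of_lt_left (by positivity))
  have hf : Continuous f := continuous_const.div (by fun_prop) fun t => (hpos t).ne'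
  set b := star a * a with hb
  have hbs : IsSelfAdjoint b := .star_mul_self a
  have hc : IsSelfAdjoint (cfc f b) := cfc_predicate f b
  refine ⟨a * cfc f b, ?_, ?_⟩
  · have h1 : π (cfc f b) = 1 := by
      rcases subsingleton_or_nontrivial B with hB | hB
      · exact Subsingleton.elim _ _
      have h2 : π (cfc f b) = cfc f (π b) :=
        StarAlgHomClass.map_cfc (S := ℂ) π f b hf.continuousOn (map_continuous π) hbs (hbs.map π)
      rw [h2, ← cfc_one ℝ (π b) (hbs.map π)]
      refine cfc_congr fun t ht => ?_
      have h3 : t ≤ r ^ 2 := by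
        have := spectrum.norm_le_norm_of_mem ht
        rw [hb, map_mul, map_star, CStarRing.norm_star_mul_self] at this
        calc t ≤ ‖t‖ := Real.le_norm_self t
          _ ≤ ‖π a‖ * ‖π a‖ := this
          _ ≤ r * r := by gcongr
          _ = _ := by ring
      simp only [f, max_eq_left h3, Real.sqrt_sq hr.le, Pi.one_apply]
      exact div_self hr.ne'
    rw [map_mul, h1, mul_one]
  · have h1 : star (a * cfc f b) * (a * cfc f b) = cfc (fun t => f t * (t * f t)) b := by
      rw [cfc_mul f (fun t => t * f t) b hf.continuousOn (by fun_prop),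
        cfc_mul (fun t => t) f b (by fun_prop) hf.continuousOn, cfc_id' ℝ b, star_mul, hc.star_eq,
        hb]
      simp only [mul_assoc]
    have h2 : ‖a * cfc f b‖ * ‖a * cfc f b‖ ≤ r * r := by
      rw [← CStarRing.norm_star_mul_self, h1]
      refine norm_cfc_le (by positivity) fun t ht => ?_
      have ht0 : 0 ≤ t := spectrum_star_mul_self_nonneg _ ht
      have h3 : f t * (t * f t) = r * r * (t / max (r ^ 2) t) := by
        have h4 : √(max (r ^ 2) t) ^ 2 = max (r ^ 2) t :=
          Real.sq_sqrt (by positivity)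
        rw [← h4]
        simp only [f]
        field_simp
      have h5 : t / max (r ^ 2) t ≤ 1 := div_le_one_of_le₀ (le_max_right _ _) (by positivity)
      rw [h3, Real.norm_of_nonneg (by positivity)]
      exact mul_le_of_le_one_right (by positivity) h5
    exact abs_le_of_sq_le_sq' (by nlinarith) hr.le |>.2

open scoped CStarAlgebra in
/-- The range of a `*`-homomorphism of C*-algebras is closed. -/
theorem isClosed_range_starAlgHom {A B : Type*} [CStarAlgebra A] [CStarAlgebra B]
    (π : A →⋆ₐ[ℂ] B) : IsClosed (π.range : Set B) := by
  let f : NormedAddGroupHom A B := (π : A →+ B).mkNormedAddGroupHom 1 fun a => by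
    rw [one_mul]; exact NonUnitalStarAlgHom.norm_apply_le π a
  have hf : ∀ a, f a = π a := fun a => rfl
  have h : f.SurjectiveOnWith f.range 1 := by
    rintro _ ⟨a, rfl⟩
    by_cases h0 : f a = 0
    · exact ⟨0, by simp [h0], by simp⟩
    obtain ⟨a', h1, h2⟩ := exists_lift_norm_le π (norm_pos_iff.2 h0) a le_rfl
    exact ⟨a', h1, by simpa using h2⟩
  have h2 := controlled_closure_of_complete one_pos one_pos h
  refine isClosed_of_closure_subset fun b hb => ?_
  obtain ⟨a, ha, -⟩ := h2 b (by
    change b ∈ closure (f.range : Set B)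
    exact hb)
  exact ⟨a, ha⟩

/-- Bounded sequences in unital C*-algebras form a unital C*-algebra. -/
noncomputable instance lpInftyCStarAlgebra {I : Type*} (A : I → Type*) [∀ i, Nontrivial (A i)]
    [∀ i, CStarAlgebra (A i)] : CStarAlgebra (lp A ⊤) where

end

/-! ### Tracial states, the GNS representation and its quotient -/

section

open scoped InnerProductSpace ComplexOrder
open Filter Topology

/-- A tracial state on a C*-algebra, not necessarily faithful. -/
structure IsTracialState {A : Type*} [CStarAlgebra A] (σ : A →ₗ[ℂ] ℂ) : Prop where
  nonneg_re : ∀ x : A, 0 ≤ (σ (star x * x)).re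
  nonneg_im : ∀ x : A, (σ (star x * x)).im = 0
  unital : σ 1 = 1
  tracial : ∀ x y : A, σ (x * y) = σ (y * x)

theorem IsTracialWStar.isTracialState {M : Type*} [CStarAlgebra M] {τ : M →ₗ[ℂ] ℂ}
    (h : IsTracialWStar τ) : IsTracialState τ :=
  ⟨h.nonneg_re, h.nonneg_im, h.unital, h.tracial⟩

theorem IsTracialState.nontrivial {A : Type*} [CStarAlgebra A] {σ : A →ₗ[ℂ] ℂ}
    (h : IsTracialState σ) : Nontrivial A := by
  refine ⟨1, 0, fun h0 => ?_⟩
  have := h.unital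
  rw [h0, map_zero] at this
  exact zero_ne_one this

/-- A tracial state as a positive linear map, for a star-ordered structure on the algebra. -/
noncomputable def IsTracialState.toPositive {A : Type*} [CStarAlgebra A] [PartialOrder A]
    [StarOrderedRing A] {σ : A →ₗ[ℂ] ℂ} (h : IsTracialState σ) : A →ₚ[ℂ] ℂ :=
  PositiveLinearMap.mk₀ σ fun a ha => by
    obtain ⟨b, rfl⟩ := CStarAlgebra.nonneg_iff_eq_star_mul_self.1 ha
    exact Complex.nonneg_iff.2 ⟨h.nonneg_re b, (h.nonneg_im b).symm⟩

section GNS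

variable {A : Type*} [CStarAlgebra A] [PartialOrder A] [StarOrderedRing A]

/-- The cyclic vector of the GNS representation. -/
noncomputable def gnsVector (f : A →ₚ[ℂ] ℂ) : f.GNS := ((f.toPreGNS 1 : f.PreGNS) : f.GNS)

theorem gnsStarAlgHom_gnsVector (f : A →ₚ[ℂ] ℂ) (a : A) :
    f.gnsStarAlgHom a (gnsVector f) = ((f.toPreGNS a : f.PreGNS) : f.GNS) := by
  change f.gnsNonUnitalStarAlgHom a ((f.toPreGNS 1 : f.PreGNS) : f.GNS) = _
  rw [PositiveLinearMap.gnsNonUnitalStarAlgHom_apply_coe]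
  simp

theorem inner_gnsVector (f : A →ₚ[ℂ] ℂ) (a : A) :
    ⟪gnsVector f, f.gnsStarAlgHom a (gnsVector f)⟫_ℂ = f a := by
  rw [gnsStarAlgHom_gnsVector, gnsVector, UniformSpace.Completion.inner_coe,
    PositiveLinearMap.preGNS_inner_def]
  simp

theorem norm_gnsVector (f : A →ₚ[ℂ] ℂ) (h1 : f 1 = 1) : ‖gnsVector f‖ = 1 := by
  rw [gnsVector, UniformSpace.Completion.norm_coe, PositiveLinearMap.preGNS_norm_def]
  simp [h1]

theorem norm_gnsStarAlgHom_gnsVector (f : A →ₚ[ℂ] ℂ) (a : A) :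
    ‖f.gnsStarAlgHom a (gnsVector f)‖ = norm2 f.toLinearMap a := by
  rw [gnsStarAlgHom_gnsVector, UniformSpace.Completion.norm_coe]
  rfl

/-- Traciality makes the cyclic vector `Ω` separating: `‖abΩ‖² = f(b*a*ab) = f(bb*a*a) = ⟪abb*Ω,
aΩ⟫`, and the vectors `bΩ` are dense. -/
theorem gnsStarAlgHom_eq_zero (f : A →ₚ[ℂ] ℂ) (ht : ∀ x y, f (x * y) = f (y * x)) (a : A)
    (ha : f.gnsStarAlgHom a (gnsVector f) = 0) : f.gnsStarAlgHom a = 0 := by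
  ext ξ
  induction ξ using UniformSpace.Completion.induction_on with
  | hp => exact isClosed_eq (f.gnsStarAlgHom a).continuous continuous_const
  | ih b =>
    obtain ⟨b, rfl⟩ := f.toPreGNS.surjective b
    have h1 : f.gnsStarAlgHom a ((f.toPreGNS b : f.PreGNS) : f.GNS)
        = ((f.toPreGNS (a * b) : f.PreGNS) : f.GNS) := by
      rw [← gnsStarAlgHom_gnsVector, ← gnsStarAlgHom_gnsVector, map_mul]; rfl
    have h2 : f (star (a * b) * (a * b)) = ⟪((f.toPreGNS (a * b * star b) : f.PreGNS) : f.GNS),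
        f.gnsStarAlgHom a (gnsVector f)⟫_ℂ := by
      rw [gnsStarAlgHom_gnsVector, UniformSpace.Completion.inner_coe,
        PositiveLinearMap.preGNS_inner_def]
      simp only [PositiveLinearMap.ofPreGNS_toPreGNS, star_mul, star_star]
      rw [← mul_assoc, ht, ← mul_assoc, ← mul_assoc]
    rw [ha, inner_zero_right] at h2
    rw [h1, _root_.zero_apply, ← norm_eq_zero, UniformSpace.Completion.norm_coe, PositiveLinearMap.preGNS_norm_def]
    simp [-star_mul, h2]

end GNS

theorem IsTracialState.norm_apply_le {A : Type*} [CStarAlgebra A] {σ : A →ₗ[ℂ] ℂ}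
    (h : IsTracialState σ) (a : A) : ‖σ a‖ ≤ ‖a‖ := by
  let _ := CStarAlgebra.spectralOrder A
  have := CStarAlgebra.spectralOrderedRing A
  have h1 : h.toPositive 1 = 1 := h.unital
  calc ‖σ a‖ = ‖⟪gnsVector h.toPositive, h.toPositive.gnsStarAlgHom a (gnsVector h.toPositive)⟫_ℂ‖ := by
        rw [inner_gnsVector]; rfl
    _ ≤ ‖gnsVector h.toPositive‖ * ‖h.toPositive.gnsStarAlgHom a (gnsVector h.toPositive)‖ :=
      norm_inner_le_norm _ _
    _ ≤ ‖gnsVector h.toPositive‖ * (‖h.toPositive.gnsStarAlgHom a‖ * ‖gnsVector h.toPositive‖) := by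
      gcongr; exact ContinuousLinearMap.le_opNorm _ _
    _ = ‖h.toPositive.gnsStarAlgHom a‖ := by rw [norm_gnsVector _ h1]; ring
    _ ≤ ‖a‖ := NonUnitalStarAlgHom.norm_apply_le _ _

/-- A C*-algebra with a faithful tracial state, coming from a vector in a Hilbert space on which
the unit ball acts with closed image, is a tracial W*-algebra. -/
theorem IsTracialState.isTracialWStar {N : Type u} {H : Type v} [CStarAlgebra N] {τ : N →ₗ[ℂ] ℂ}
    (h : IsTracialState τ) [NormedAddCommGroup H] [InnerProductSpace ℂ H] [CompleteSpace H]
    (j : N →L[ℂ] H) (hτ : ∀ x, τ x = ⟪j 1, j x⟫_ℂ) (hj : Function.Injective j)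
    (hf : ∀ x, τ (star x * x) = 0 → j x = 0) (hc : IsClosed (j '' Metric.closedBall 0 1)) :
    IsTracialWStar τ where
  nonneg_re := h.nonneg_re
  nonneg_im := h.nonneg_im
  unital := h.unital
  tracial := h.tracial
  faithful x hx := hj (by rw [hf x hx, map_zero])
  weakStar := by
    obtain ⟨X, i₁, i₂, i₃, e, he⟩ := exists_predual j hj hc
    exact ⟨X, i₁, i₂, i₃, e, by simpa only [hτ] using he (j 1)⟩

/-- A limit point of the image is approximated by unit ball elements of `N`, which lift to the unit
ball of `A` and form a rapidly Cauchy sequence there; the completeness hypothesis supplies its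
limit. -/
theorem isClosed_image_closedBall_of_complete {A N H : Type*} [CStarAlgebra A] [CStarAlgebra N]
    [NormedAddCommGroup H] [InnerProductSpace ℂ H] {σ : A →ₗ[ℂ] ℂ} (π : A →⋆ₐ[ℂ] N)
    (hπ : Function.Surjective π) (j : N →L[ℂ] H) (hjn : ∀ a, ‖j (π a)‖ = norm2 σ a)
    (hcomp : ∀ x : ℕ → A, (∀ k, ‖x k‖ ≤ 1) →
      (∀ l m, l ≤ m → norm2 σ (x l - x m) < (1 / 2) ^ l) →
      ∃ y, ‖y‖ ≤ 1 ∧ Tendsto (fun k => norm2 σ (x k - y)) atTop (𝓝 0)) :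
    IsClosed (j '' Metric.closedBall 0 1) := by
  refine isClosed_of_closure_subset fun ξ hξ => ?_
  -- The extra half lets the errors at `l ≤ m` add up to less than `(1 / 2) ^ l`.
  have h1 : ∀ k : ℕ, ∃ a, ‖a‖ ≤ 1 ∧ dist ξ (j (π a)) < (1 / 2) ^ k / 2 := fun k => by
    obtain ⟨_, ⟨x, hx, rfl⟩, hd⟩ := Metric.mem_closure_iff.1 hξ ((1 / 2) ^ k / 2) (by positivity)
    obtain ⟨b, rfl⟩ := hπ x
    obtain ⟨a, ha, ha'⟩ := exists_lift_norm_le π one_pos b (by simpa using hx)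
    exact ⟨a, ha', by rwa [ha]⟩
  choose a ha hd using h1
  obtain ⟨y, hy, hlim⟩ := hcomp a ha fun l m hlm => by
    rw [← hjn, map_sub, map_sub, ← dist_eq_norm]
    have h2 : ((1 : ℝ) / 2) ^ m ≤ (1 / 2) ^ l := pow_le_pow_of_le_one (by norm_num) (by norm_num) hlm
    have h3 := dist_triangle_left (j (π (a l))) (j (π (a m))) ξ
    linarith [hd l, hd m]
  refine ⟨π y, ?_, ?_⟩
  · rw [mem_closedBall_zero_iff]
    exact (NonUnitalStarAlgHom.norm_apply_le π y).trans hy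
  · have h4 : Tendsto (fun k => j (π (a k))) atTop (𝓝 (j (π y))) := by
      rw [tendsto_iff_norm_sub_tendsto_zero]
      refine hlim.congr fun k => ?_
      rw [← hjn, map_sub π, map_sub j]
    have h5 : Tendsto (fun k => j (π (a k))) atTop (𝓝 ξ) := by
      rw [tendsto_iff_dist_tendsto_zero]
      refine squeeze_zero (fun _ => dist_nonneg) (fun k => ?_)
        (tendsto_pow_atTop_nhds_zero_of_lt_one (r := (1 / 2 : ℝ)) (by norm_num) (by norm_num))
      rw [dist_comm]
      have : (0 : ℝ) < (1 / 2) ^ k := by positivity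
      linarith [hd k]
    exact tendsto_nhds_unique h4 h5

/-- The GNS quotient of a C*-algebra by a tracial state with a completeness property of the unit
ball is a tracial W*-algebra. -/
theorem IsTracialState.exists_quotient {A : Type u} [CStarAlgebra A] {σ : A →ₗ[ℂ] ℂ}
    (h : IsTracialState σ)
    (hcomp : ∀ x : ℕ → A, (∀ k, ‖x k‖ ≤ 1) →
      (∀ l m, l ≤ m → norm2 σ (x l - x m) < (1 / 2) ^ l) →
      ∃ y, ‖y‖ ≤ 1 ∧ Tendsto (fun k => norm2 σ (x k - y)) atTop (𝓝 0)) :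
    ∃ (N : Type u) (_ : CStarAlgebra N) (τ : N →ₗ[ℂ] ℂ) (π : A →⋆ₐ[ℂ] N),
      IsTracialWStar τ ∧ Function.Surjective π ∧ ∀ a, τ (π a) = σ a := by
  let _ := CStarAlgebra.spectralOrder A
  have := CStarAlgebra.spectralOrderedRing A
  let f := h.toPositive
  have hfσ : ∀ a, f a = σ a := fun a => rfl
  -- No weak closure is taken: the range is norm closed, hence a C*-algebra, and completeness of the
  -- unit ball already yields a predual.
  let S : StarSubalgebra ℂ (f.GNS →L[ℂ] f.GNS) := f.gnsStarAlgHom.range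
  have hS : IsClosed (S : Set (f.GNS →L[ℂ] f.GNS)) := isClosed_range_starAlgHom f.gnsStarAlgHom
  let iN : CStarAlgebra S := StarSubalgebra.cstarAlgebra S
  let π : A →⋆ₐ[ℂ] S := f.gnsStarAlgHom.rangeRestrict
  have hπ : Function.Surjective π := f.gnsStarAlgHom.rangeRestrict_surjective
  let Ω := gnsVector f
  let j : S →L[ℂ] f.GNS := (ContinuousLinearMap.apply ℂ f.GNS Ω).comp S.toSubmodule.subtypeL
  have hjπ : ∀ a, j (π a) = f.gnsStarAlgHom a Ω := fun a => rfl
  have hj0 : ∀ a, j (π a) = 0 → π a = 0 := fun a ha =>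
    Subtype.ext (gnsStarAlgHom_eq_zero f h.tracial a ha)
  let τ : S →ₗ[ℂ] ℂ := (innerSL ℂ Ω).toLinearMap ∘ₗ j.toLinearMap
  have hτj : ∀ x, τ x = ⟪Ω, j x⟫_ℂ := fun x => rfl
  have hτ : ∀ a, τ (π a) = σ a := fun a => inner_gnsVector f a
  have hs : ∀ a, star (π a) * π a = π (star a * a) := fun a => by rw [map_mul, map_star]
  have hjn : ∀ a, ‖j (π a)‖ = norm2 σ a := fun a => norm_gnsStarAlgHom_gnsVector f a
  refine ⟨S, iN, τ, π, IsTracialState.isTracialWStar (j := j) ⟨?_, ?_, ?_, ?_⟩ ?_ ?_ ?_ ?_, hπ, hτ⟩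
  · intro x
    obtain ⟨a, rfl⟩ := hπ x
    rw [hs, hτ]; exact h.nonneg_re a
  · intro x
    obtain ⟨a, rfl⟩ := hπ x
    rw [hs, hτ]; exact h.nonneg_im a
  · rw [← map_one π, hτ]; exact h.unital
  · intro x y
    obtain ⟨a, rfl⟩ := hπ x
    obtain ⟨b, rfl⟩ := hπ y
    rw [← map_mul, ← map_mul, hτ, hτ]; exact h.tracial a b
  · intro x; rfl
  · refine (injective_iff_map_eq_zero j).2 fun x hx => ?_
    obtain ⟨a, rfl⟩ := hπ x
    exact hj0 a hx
  · intro x hx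
    obtain ⟨a, rfl⟩ := hπ x
    rw [hs, hτ] at hx
    rw [← norm_eq_zero, hjn, norm2, hx]
    simp
  · exact isClosed_image_closedBall_of_complete π hπ j hjn hcomp

end

/-! ### Tracial ultraproducts -/

section

open Filter Topology

section Ultraproduct

variable {I : Type v} (U : Ultrafilter I) {M : I → Type u} [∀ i, CStarAlgebra (M i)]
  {τ : ∀ i, M i →ₗ[ℂ] ℂ}

theorem exists_tendsto_trace (hτ : ∀ i, IsTracialState (τ i)) (x : lp M ⊤) :
    ∃ z, Tendsto (fun i => τ i (x i)) U (𝓝 z) := by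
  obtain ⟨z, -, hz⟩ := (isCompact_closedBall (0 : ℂ) ‖x‖).ultrafilter_le_nhds
    (U.map fun i => τ i (x i)) (le_principal_iff.2 (Ultrafilter.mem_map.2 (univ_mem' fun i => by
      rw [Set.mem_preimage, mem_closedBall_zero_iff]
      exact ((hτ i).norm_apply_le _).trans (lp.norm_apply_le_norm (by simp) x i))))
  exact ⟨z, hz⟩

variable [∀ i, Nontrivial (M i)]

/-- The limit along an ultrafilter of tracial states, on bounded sequences. -/
noncomputable def ultraTrace (hτ : ∀ i, IsTracialState (τ i)) : lp M ⊤ →ₗ[ℂ] ℂ where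
  toFun x := (exists_tendsto_trace U hτ x).choose
  map_add' x y := by
    refine tendsto_nhds_unique (exists_tendsto_trace U hτ (x + y)).choose_spec ?_
    simpa using (exists_tendsto_trace U hτ x).choose_spec.add
      (exists_tendsto_trace U hτ y).choose_spec
  map_smul' c x := by
    refine tendsto_nhds_unique (exists_tendsto_trace U hτ (c • x)).choose_spec ?_
    simpa using (exists_tendsto_trace U hτ x).choose_spec.const_mul c

theorem tendsto_ultraTrace (hτ : ∀ i, IsTracialState (τ i)) (x : lp M ⊤) :
    Tendsto (fun i => τ i (x i)) U (𝓝 (ultraTrace U hτ x)) :=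
  (exists_tendsto_trace U hτ x).choose_spec

theorem isTracialState_ultraTrace (hτ : ∀ i, IsTracialState (τ i)) :
    IsTracialState (ultraTrace U hτ) where
  nonneg_re x := ge_of_tendsto' ((Complex.continuous_re.tendsto _).comp (tendsto_ultraTrace U hτ _))
    fun i => (hτ i).nonneg_re (x i)
  nonneg_im x := tendsto_nhds_unique
    ((Complex.continuous_im.tendsto _).comp (tendsto_ultraTrace U hτ _))
    (tendsto_const_nhds.congr fun i => ((hτ i).nonneg_im (x i)).symm)
  unital := tendsto_nhds_unique (tendsto_ultraTrace U hτ _)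
    (tendsto_const_nhds.congr fun i => (hτ i).unital.symm)
  tracial x y := tendsto_nhds_unique (tendsto_ultraTrace U hτ _)
    ((tendsto_ultraTrace U hτ _).congr fun i => (hτ i).tracial (y i) (x i))

theorem tendsto_norm2_ultraTrace (hτ : ∀ i, IsTracialState (τ i)) (x : lp M ⊤) :
    Tendsto (fun i => norm2 (τ i) (x i)) U (𝓝 (norm2 (ultraTrace U hτ) x)) :=
  (Real.continuous_sqrt.tendsto _).comp
    ((Complex.continuous_re.tendsto _).comp (tendsto_ultraTrace U hτ (star x * x)))

/-- A diagonal argument: coordinate `i` of the limit is taken from `x k`, with `k ≤ ν i` as large as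
possible such that the Cauchy estimates up to `k` hold at `i`. The cap `ν i` makes a largest `k`
exist, and `ν → ∞` along `U` makes it tend to infinity. -/
theorem ultraTrace_complete (hτ : ∀ i, IsTracialState (τ i)) {ν : I → ℕ}
    (hν : Tendsto ν U atTop) (x : ℕ → lp M ⊤) (hx : ∀ k, ‖x k‖ ≤ 1)
    (hc : ∀ l m, l ≤ m → norm2 (ultraTrace U hτ) (x l - x m) < (1 / 2) ^ l) :
    ∃ y, ‖y‖ ≤ 1 ∧ Tendsto (fun k => norm2 (ultraTrace U hτ) (x k - y)) atTop (𝓝 0) := by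
  classical
  let P : I → ℕ → Prop := fun i k =>
    ∀ m ∈ Finset.range (k + 1), ∀ l ∈ Finset.range (m + 1), norm2 (τ i) (x l i - x m i) < (1 / 2) ^ l
  have hP0 : ∀ i, P i 0 := fun i m hm l hl => by
    obtain rfl : m = 0 := by simpa using hm
    obtain rfl : l = 0 := by simpa using hl
    simp [norm2]
  have hP : ∀ k, ∀ᶠ i in U, P i k := fun k => by
    refine (Finset.eventually_all _).2 fun m _ => (Finset.eventually_all _).2 fun l hl => ?_
    exact (tendsto_norm2_ultraTrace U hτ (x l - x m)).eventually_lt_const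
      (hc l m (Finset.mem_range_succ_iff.1 hl))
  let κ : I → ℕ := fun i => Nat.findGreatest (P i) (ν i)
  have hκ : ∀ i, P i (κ i) := fun i => Nat.findGreatest_spec (Nat.zero_le _) (hP0 i)
  have hκ' : ∀ l, ∀ᶠ i in U, l ≤ κ i := fun l => by
    filter_upwards [hP l, hν.eventually_ge_atTop l] with i h1 h2 using Nat.le_findGreatest h2 h1
  have hyn : ∀ i, ‖x (κ i) i‖ ≤ 1 := fun i =>
    (lp.norm_apply_le_norm (by simp) (x (κ i)) i).trans (hx _)
  let y : lp M ⊤ := ⟨fun i => x (κ i) i, memℓp_infty ⟨1, by rintro _ ⟨i, rfl⟩; exact hyn i⟩⟩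
  refine ⟨y, lp.norm_le_of_forall_le zero_le_one hyn, ?_⟩
  refine squeeze_zero (fun _ => Real.sqrt_nonneg _) (fun l => ?_)
    (tendsto_pow_atTop_nhds_zero_of_lt_one (r := (1 / 2 : ℝ)) (by norm_num) (by norm_num))
  refine le_of_tendsto (tendsto_norm2_ultraTrace U hτ (x l - y)) ?_
  filter_upwards [hκ' l] with i hi
  exact (hκ i (κ i) (Finset.self_mem_range_succ _) l (Finset.mem_range_succ_iff.2 hi)).le

end Ultraproduct

/-- The tracial ultraproduct along a countably incomplete ultrafilter is a tracial W*-algebra. -/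
theorem exists_ultraproduct {I : Type} (U : Ultrafilter I) {M : I → Type u}
    [∀ i, CStarAlgebra (M i)] [∀ i, Nontrivial (M i)] {τ : ∀ i, M i →ₗ[ℂ] ℂ}
    (hτ : ∀ i, IsTracialState (τ i)) {ν : I → ℕ} (hν : Tendsto ν U atTop) :
    ∃ (N : Type u) (_ : CStarAlgebra N) (σ : N →ₗ[ℂ] ℂ) (π : lp M ⊤ →⋆ₐ[ℂ] N),
      IsTracialWStar σ ∧ Function.Surjective π ∧
        ∀ x, Tendsto (fun i => τ i (x i)) U (𝓝 (σ (π x))) := by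
  obtain ⟨N, _, σ, π, h, hs, hσ⟩ := (isTracialState_ultraTrace U hτ).exists_quotient
    (fun x => ultraTrace_complete U hτ hν x)
  exact ⟨N, _, σ, π, h, hs, fun x => by rw [hσ]; exact tendsto_ultraTrace U hτ x⟩

end

section

open Filter Topology

/-! ### Boundedness of formulas -/

theorem exists_bound_freeAlgebra {d : ℕ} (p : FreeAlgebra ℂ (Fin d)) (B : Fin d → ℝ) :
    ∃ C : ℝ, ∀ (M : Type u) [CStarAlgebra M] [Nontrivial M] (X : Fin d → M),
      (∀ i, ‖X i‖ ≤ B i) → ‖FreeAlgebra.lift ℂ X p‖ ≤ C := by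
  induction p using FreeAlgebra.induction with
  | grade0 c => exact ⟨‖c‖, fun M _ _ X _ => by simp⟩
  | grade1 i => exact ⟨B i, fun M _ _ X hX => by simpa using hX i⟩
  | mul a b iha ihb =>
    obtain ⟨C, hC⟩ := iha
    obtain ⟨D, hD⟩ := ihb
    refine ⟨C * D, fun M _ _ X hX => ?_⟩
    rw [map_mul]
    exact (norm_mul_le _ _).trans (mul_le_mul (hC M X hX) (hD M X hX) (norm_nonneg _)
      ((norm_nonneg _).trans (hC M X hX)))
  | add a b iha ihb =>
    obtain ⟨C, hC⟩ := iha
    obtain ⟨D, hD⟩ := ihb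
    refine ⟨C + D, fun M _ _ X hX => ?_⟩
    rw [map_add]
    exact (norm_add_le _ _).trans (add_le_add (hC M X hX) (hD M X hX))

theorem Term.exists_bound (t : Term) (R : ℕ → ℝ) :
    ∃ C : ℝ, ∀ (M : Type u) [CStarAlgebra M] [Nontrivial M] (X : ℕ → M),
      (∀ j, ‖X j‖ ≤ R j) → ‖t.eval X‖ ≤ C := by
  induction t with
  | var j => exact ⟨R j, fun M _ _ X hX => hX j⟩
  | zero => exact ⟨0, fun M _ _ X _ => by simp [Term.eval]⟩
  | one => exact ⟨1, fun M _ _ X _ => by simp [Term.eval]⟩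
  | add s t ihs iht =>
    obtain ⟨C, hC⟩ := ihs
    obtain ⟨D, hD⟩ := iht
    exact ⟨C + D, fun M _ _ X hX => (norm_add_le _ _).trans (add_le_add (hC M X hX) (hD M X hX))⟩
  | mul s t ihs iht =>
    obtain ⟨C, hC⟩ := ihs
    obtain ⟨D, hD⟩ := iht
    exact ⟨C * D, fun M _ _ X hX => (norm_mul_le _ _).trans (mul_le_mul (hC M X hX) (hD M X hX)
      (norm_nonneg _) ((norm_nonneg _).trans (hC M X hX)))⟩
  | star t ih =>
    obtain ⟨C, hC⟩ := ih
    exact ⟨C, fun M _ _ X hX => by rw [Term.eval, norm_star]; exact hC M X hX⟩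
  | smul c t ih =>
    obtain ⟨C, hC⟩ := ih
    exact ⟨‖c‖ * C, fun M _ _ X hX => by
      rw [Term.eval, norm_smul]; exact mul_le_mul_of_nonneg_left (hC M X hX) (norm_nonneg _)⟩
  | poly d p t ih =>
    choose B hB using ih
    obtain ⟨C, hC⟩ := exists_bound_freeAlgebra.{u} p B
    exact ⟨C, fun M _ _ X hX => hC M _ fun i => hB i M X hX⟩

theorem IsTracialState.norm2_le {A : Type*} [CStarAlgebra A] {σ : A →ₗ[ℂ] ℂ}
    (h : IsTracialState σ) (a : A) : norm2 σ a ≤ ‖a‖ := by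
  refine Real.sqrt_le_iff.2 ⟨norm_nonneg _, ?_⟩
  rw [pow_two, ← CStarRing.norm_star_mul_self]
  exact (Complex.re_le_norm _).trans (h.norm_apply_le _)

theorem norm_update_le {M : Type*} [Norm M] {X : ℕ → M} {R : ℕ → ℝ} (hX : ∀ j, ‖X j‖ ≤ R j) (j : ℕ)
    {Y : M} {r : ℝ} (hY : ‖Y‖ ≤ r) (k : ℕ) : ‖Function.update X j Y k‖ ≤ Function.update R j r k := by
  by_cases h : k = j
  · subst h; simpa using hY
  · simpa [h] using hX k

/-- Uniformity over bounded tuples ensures that the infima and suprema in formulas are over bounded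
families, rather than default values of real `⨅` and `⨆`. The radii are generalized because a
quantifier changes one of them. -/
theorem Formula.exists_bound (φ : Formula) (R : ℕ → ℝ) :
    ∃ C : ℝ, ∀ (M : Type u) [CStarAlgebra M] (τ : M →ₗ[ℂ] ℂ), IsTracialState τ → ∀ X : ℕ → M,
      (∀ j, ‖X j‖ ≤ R j) → |φ.eval τ X| ≤ C := by
  induction φ generalizing R with
  | reTr t =>
    obtain ⟨C, hC⟩ := t.exists_bound.{u} R
    refine ⟨C, fun M _ τ hτ X hX => ?_⟩
    have := hτ.nontrivial
    exact (Complex.abs_re_le_norm _).trans ((hτ.norm_apply_le _).trans (hC M X hX))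
  | imTr t =>
    obtain ⟨C, hC⟩ := t.exists_bound.{u} R
    refine ⟨C, fun M _ τ hτ X hX => ?_⟩
    have := hτ.nontrivial
    exact (Complex.abs_im_le_norm _).trans ((hτ.norm_apply_le _).trans (hC M X hX))
  | dist s t =>
    obtain ⟨C, hC⟩ := s.exists_bound.{u} R
    obtain ⟨D, hD⟩ := t.exists_bound.{u} R
    refine ⟨C + D, fun M _ τ hτ X hX => ?_⟩
    have := hτ.nontrivial
    rw [Formula.eval, norm2, abs_of_nonneg (Real.sqrt_nonneg _)]
    exact (hτ.norm2_le _).trans ((norm_sub_le _ _).trans (add_le_add (hC M X hX) (hD M X hX)))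
  | conn n F φ ih =>
    choose C hC using fun i => ih i R
    have hK : IsCompact (Set.pi Set.univ fun i => Set.Icc (-C i) (C i)) :=
      isCompact_univ_pi fun i => isCompact_Icc
    obtain ⟨D, hD⟩ := hK.exists_bound_of_continuousOn F.continuous.continuousOn
    exact ⟨D, fun M _ τ hτ X hX => hD _ fun i _ => abs_le.1 (hC i M τ hτ X hX)⟩
  | inf r j φ ih =>
    obtain ⟨C, hC⟩ := ih (Function.update R j r)
    refine ⟨C, fun M _ τ hτ X hX => ?_⟩
    have hb : ∀ Y : {Y : M // ‖Y‖ ≤ r}, |φ.eval τ (Function.update X j Y)| ≤ C :=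
      fun Y => hC M τ hτ _ (norm_update_le hX j Y.2)
    have : Nonempty {Y : M // ‖Y‖ ≤ r} := ⟨⟨0, by simpa using (Set.mem_Ioi.1 r.2).le⟩⟩
    rw [Formula.eval]
    refine abs_le.2 ⟨le_ciInf fun Y => (abs_le.1 (hb Y)).1, ?_⟩
    exact ciInf_le_of_le ⟨-C, by rintro _ ⟨Y, rfl⟩; exact (abs_le.1 (hb Y)).1⟩ this.some
      (abs_le.1 (hb _)).2
  | sup r j φ ih =>
    obtain ⟨C, hC⟩ := ih (Function.update R j r)
    refine ⟨C, fun M _ τ hτ X hX => ?_⟩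
    have hb : ∀ Y : {Y : M // ‖Y‖ ≤ r}, |φ.eval τ (Function.update X j Y)| ≤ C :=
      fun Y => hC M τ hτ _ (norm_update_le hX j Y.2)
    have : Nonempty {Y : M // ‖Y‖ ≤ r} := ⟨⟨0, by simpa using (Set.mem_Ioi.1 r.2).le⟩⟩
    rw [Formula.eval]
    refine abs_le.2 ⟨?_, ciSup_le fun Y => (abs_le.1 (hb Y)).2⟩
    exact le_ciSup_of_le ⟨C, by rintro _ ⟨Y, rfl⟩; exact (abs_le.1 (hb Y)).2⟩ this.some
      (abs_le.1 (hb _)).1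

/-! ### Evaluation of terms under homomorphisms -/

theorem Term.eval_map {A : Type u} {B : Type v} [CStarAlgebra A] [CStarAlgebra B] (π : A →⋆ₐ[ℂ] B)
    (X : ℕ → A) (t : Term) : t.eval (fun j => π (X j)) = π (t.eval X) := by
  induction t with
  | var j => rfl
  | zero => exact (map_zero π).symm
  | one => exact (map_one π).symm
  | add s t ihs iht => simp only [Term.eval, ihs, iht, map_add]
  | mul s t ihs iht => simp only [Term.eval, ihs, iht, map_mul]
  | star t ih => simp only [Term.eval, ih, map_star]
  | smul c t ih => simp only [Term.eval, ih, map_smul]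
  | poly d p t ih =>
    simp only [Term.eval, ih]
    have : (π : A →ₐ[ℂ] B).comp (FreeAlgebra.lift ℂ fun i => (t i).eval X)
        = FreeAlgebra.lift ℂ fun i => π ((t i).eval X) := by
      ext i; simp
    rw [← this]; rfl

theorem update_map {α : Type u} {β : Type v} (f : α → β) (X : ℕ → α) (j : ℕ) (y : α) :
    (fun k => f (Function.update X j y k)) = Function.update (fun k => f (X k)) j (f y) := by
  funext k
  exact Function.apply_update (fun _ => f) X j y k

/-- Evaluation at an index, on bounded sequences. -/
noncomputable def lpEval {I : Type*} (M : I → Type*) [∀ i, CStarAlgebra (M i)]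
    [∀ i, Nontrivial (M i)] (i : I) : lp M ⊤ →⋆ₐ[ℂ] M i where
  toFun x := x i
  map_one' := rfl
  map_mul' _ _ := rfl
  map_zero' := rfl
  map_add' _ _ := rfl
  commutes' _ := rfl
  map_star' _ := rfl

end

section

open Filter Topology

/-! ### Łoś's theorem -/

/-- Reduces `sup` quantifiers to `inf`. No boundedness is needed, since the real infimum is defined
by negating a supremum. -/
theorem iSup_eq_neg_iInf_neg {ι : Type*} (f : ι → ℝ) : ⨆ i, f i = -⨅ i, -f i := by
  rw [iInf, Real.sInf_def, neg_neg, iSup]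
  congr 1
  ext x
  simp [neg_eq_iff_eq_neg]

section Los

variable {I : Type v} {U : Ultrafilter I} {M : I → Type u} [∀ i, CStarAlgebra (M i)]
  [∀ i, Nontrivial (M i)] {N : Type u} [CStarAlgebra N] {π : lp M ⊤ →⋆ₐ[ℂ] N}

/-- The quantifier step of Łoś. Near-minimizers in the coordinates assemble into one bounded
sequence, and a near-minimizer in `N` lifts to a sequence with the same norm bound, whose
coordinates are competitors. -/
theorem tendsto_iInf_ball (hπ : Function.Surjective π) {r : ℝ} (hr : 0 < r) {g : ∀ i, M i → ℝ}
    {G : N → ℝ} (hg : ∀ i, BddBelow (Set.range fun y : {y : M i // ‖y‖ ≤ r} => g i y))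
    (hG : BddBelow (Set.range fun y : {y : N // ‖y‖ ≤ r} => G y))
    (h : ∀ y : lp M ⊤, Tendsto (fun i => g i (y i)) U (𝓝 (G (π y)))) :
    Tendsto (fun i => ⨅ y : {y : M i // ‖y‖ ≤ r}, g i y) U
      (𝓝 (⨅ y : {y : N // ‖y‖ ≤ r}, G y)) := by
  have hne : ∀ i, Nonempty {y : M i // ‖y‖ ≤ r} := fun i => ⟨⟨0, by simpa using hr.le⟩⟩
  have : Nonempty {y : N // ‖y‖ ≤ r} := ⟨⟨0, by simpa using hr.le⟩⟩
  refine tendsto_order.2 ⟨fun a ha => ?_, fun a ha => ?_⟩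
  · obtain ⟨b, hab, hb⟩ := exists_between ha
    by_contra hnot
    have hev : ∀ᶠ i in U, ⨅ y : {y : M i // ‖y‖ ≤ r}, g i y ≤ a := by
      filter_upwards [Ultrafilter.eventually_not.2 hnot] with i hi using not_lt.1 hi
    have hch : ∀ i, ∃ y : {y : M i // ‖y‖ ≤ r}, ⨅ y : {y : M i // ‖y‖ ≤ r}, g i y ≤ a →
        g i y < b := fun i => by
      by_cases hi : ⨅ y : {y : M i // ‖y‖ ≤ r}, g i y ≤ a
      · obtain ⟨y, hy⟩ := exists_lt_of_ciInf_lt (hi.trans_lt hab)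
        exact ⟨y, fun _ => hy⟩
      · exact ⟨(hne i).some, fun h => absurd h hi⟩
    choose y hy using hch
    let z : lp M ⊤ := ⟨fun i => y i, memℓp_infty ⟨r, by rintro _ ⟨i, rfl⟩; exact (y i).2⟩⟩
    have hz : ‖z‖ ≤ r := lp.norm_le_of_forall_le hr.le fun i => (y i).2
    have h1 : G (π z) ≤ b := le_of_tendsto (h z) (by
      filter_upwards [hev] with i hi using (hy i hi).le)
    have h2 := ciInf_le hG ⟨π z, (NonUnitalStarAlgHom.norm_apply_le π z).trans hz⟩
    exact absurd (h2.trans h1) (not_le.2 hb)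
  · obtain ⟨⟨y, hy⟩, hya⟩ := exists_lt_of_ciInf_lt ha
    obtain ⟨x, rfl⟩ := hπ y
    obtain ⟨z, hz, hzr⟩ := exists_lift_norm_le π hr x hy
    have h1 := h z
    rw [hz] at h1
    filter_upwards [h1.eventually_lt_const hya] with i hi
    exact (ciInf_le (hg i) ⟨z i, (lp.norm_apply_le_norm (by simp) z i).trans hzr⟩).trans_lt hi

theorem Formula.bddBelow_range_update {A : Type u} [CStarAlgebra A] {τ : A →ₗ[ℂ] ℂ}
    (hτ : IsTracialState τ) (φ : Formula) (X : ℕ → A) (j : ℕ) (r : ℝ) :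
    BddBelow (Set.range fun y : {y : A // ‖y‖ ≤ r} => φ.eval τ (Function.update X j y)) := by
  obtain ⟨C, hC⟩ := φ.exists_bound.{u} (Function.update (fun j => ‖X j‖) j r)
  refine ⟨-C, ?_⟩
  rintro _ ⟨y, rfl⟩
  exact (abs_le.1 (hC A τ hτ _ (norm_update_le (fun _ => le_rfl) j y.2))).1

theorem Formula.bddBelow_range_neg_update {A : Type u} [CStarAlgebra A] {τ : A →ₗ[ℂ] ℂ}
    (hτ : IsTracialState τ) (φ : Formula) (X : ℕ → A) (j : ℕ) (r : ℝ) :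
    BddBelow (Set.range fun y : {y : A // ‖y‖ ≤ r} => -φ.eval τ (Function.update X j y)) := by
  obtain ⟨C, hC⟩ := φ.exists_bound.{u} (Function.update (fun j => ‖X j‖) j r)
  refine ⟨-C, ?_⟩
  rintro _ ⟨y, rfl⟩
  exact neg_le_neg (abs_le.1 (hC A τ hτ _ (norm_update_le (fun _ => le_rfl) j y.2))).2

theorem Formula.tendsto_eval {τ : ∀ i, M i →ₗ[ℂ] ℂ} (hτ : ∀ i, IsTracialState (τ i))
    {σ : N →ₗ[ℂ] ℂ} (hσ : IsTracialState σ) (hπ : Function.Surjective π)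
    (h : ∀ x, Tendsto (fun i => τ i (x i)) U (𝓝 (σ (π x)))) (φ : Formula) (X : ℕ → lp M ⊤) :
    Tendsto (fun i => φ.eval (τ i) fun j => X j i) U (𝓝 (φ.eval σ fun j => π (X j))) := by
  have ht : ∀ (t : Term) (X : ℕ → lp M ⊤) (i : I), t.eval (fun j => X j i) = t.eval X i :=
    fun t X i => t.eval_map (lpEval M i) X
  induction φ generalizing X with
  | reTr t =>
    simp only [Formula.eval, ht, Term.eval_map]
    exact (Complex.continuous_re.tendsto _).comp (h _)
  | imTr t =>
    simp only [Formula.eval, ht, Term.eval_map]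
    exact (Complex.continuous_im.tendsto _).comp (h _)
  | dist s t =>
    simp only [Formula.eval, ht, Term.eval_map]
    rw [← map_sub]
    have := h (star (s.eval X - t.eval X) * (s.eval X - t.eval X))
    rw [map_mul, map_star] at this
    exact (Real.continuous_sqrt.tendsto _).comp ((Complex.continuous_re.tendsto _).comp this)
  | conn n F φ ih =>
    exact (F.continuous.tendsto _).comp (tendsto_pi_nhds.2 fun k => ih k X)
  | inf r j φ ih =>
    simp only [Formula.eval]
    refine tendsto_iInf_ball (g := fun i y => φ.eval (τ i) (Function.update (fun k => X k i) j y))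
      (G := fun y => φ.eval σ (Function.update (fun k => π (X k)) j y)) hπ r.2
      (fun i => φ.bddBelow_range_update (hτ i) _ j r) (φ.bddBelow_range_update hσ _ j r) fun y => ?_
    have := ih (Function.update X j y)
    rw [update_map (fun x => π x)] at this
    refine this.congr fun i => ?_
    rw [update_map (fun x : lp M ⊤ => x i)]
  | sup r j φ ih =>
    simp only [Formula.eval, iSup_eq_neg_iInf_neg]
    refine (tendsto_iInf_ball
      (g := fun i y => -φ.eval (τ i) (Function.update (fun k => X k i) j y))
      (G := fun y => -φ.eval σ (Function.update (fun k => π (X k)) j y)) hπ r.2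
      (fun i => φ.bddBelow_range_neg_update (hτ i) _ j r) (φ.bddBelow_range_neg_update hσ _ j r)
      fun y => ?_).neg
    have := (ih (Function.update X j y)).neg
    rw [update_map (fun x => π x)] at this
    refine this.congr fun i => ?_
    rw [update_map (fun x : lp M ⊤ => x i)]

end Los

/-! ### Compactness of the spaces of bounded types -/

/-- The types of tuples bounded by `r`, as functions on formulas. -/
def boundedTypes (r : Radii) : Set (Formula → ℝ) :=
  {f | ∃ (M : Type u) (_ : CStarAlgebra M) (τ : M →ₗ[ℂ] ℂ) (X : ℕ → M),
    IsTracialWStar τ ∧ (∀ j, ‖X j‖ ≤ r j) ∧ tp τ X = f}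

/-- By Łoś, an ultrafilter of types converges to the type of the tuple of representatives in their
ultraproduct, where the norm bounds persist. -/
theorem isCompact_boundedTypes (r : Radii) : IsCompact (boundedTypes.{u} r) := by
  rw [isCompact_iff_ultrafilter_le_nhds]
  intro V hV
  choose M iM τ X hτ hX htp using fun f : boundedTypes.{u} r => f.2
  have hne : (comap (Subtype.val : boundedTypes.{u} r → _) (V : Filter (Formula → ℝ))).NeBot :=
    Ultrafilter.comap_inf_principal_neBot_of_image_mem (m := Subtype.val) (s := Set.univ) (by
      simpa using le_principal_iff.1 hV) |>.mono inf_le_left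
  -- The factor `ℕ` supplies an index function tending to infinity, as the ultraproduct construction
  -- requires, even if `V` is principal.
  let W : Ultrafilter (boundedTypes.{u} r × ℕ) :=
    Ultrafilter.of (comap Subtype.val (V : Filter (Formula → ℝ)) ×ˢ atTop)
  have hW := Ultrafilter.of_le (comap (Subtype.val : boundedTypes.{u} r → _)
    (V : Filter (Formula → ℝ)) ×ˢ (atTop : Filter ℕ))
  have hW1 : Tendsto (fun i : boundedTypes.{u} r × ℕ => (i.1 : Formula → ℝ)) W V :=
    (tendsto_comap.comp tendsto_fst).mono_left hW
  have hW2 : Tendsto (fun i : boundedTypes.{u} r × ℕ => i.2) W atTop := tendsto_snd.mono_left hW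
  have hτ' : ∀ i : boundedTypes.{u} r × ℕ, IsTracialState (τ i.1) := fun i =>
    (hτ i.1).isTracialState
  have hnt : ∀ i : boundedTypes.{u} r × ℕ, Nontrivial (M i.1) := fun i => (hτ' i).nontrivial
  obtain ⟨N, iN, σ, π, hσ, hπ, hlim⟩ := exists_ultraproduct W hτ' hW2
  let x : ℕ → lp (fun i : boundedTypes.{u} r × ℕ => M i.1) ⊤ := fun j =>
    ⟨fun i => X i.1 j, memℓp_infty ⟨r j, by rintro _ ⟨i, rfl⟩; exact hX i.1 j⟩⟩
  refine ⟨tp σ fun j => π (x j), ⟨N, iN, σ, _, hσ, fun j => ?_, rfl⟩, ?_⟩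
  · exact (NonUnitalStarAlgHom.norm_apply_le π (x j)).trans
      (lp.norm_le_of_forall_le (Set.mem_Ioi.1 (r j).2).le fun i => hX i.1 j)
  · have h1 : Tendsto (fun i : boundedTypes.{u} r × ℕ => (i.1 : Formula → ℝ)) W
        (𝓝 (tp σ fun j => π (x j))) := tendsto_pi_nhds.2 fun φ => by
      refine (φ.tendsto_eval hτ' hσ.isTracialState hπ hlim x).congr fun i => ?_
      exact congrFun (htp i.1) φ
    have h2 : W.map (fun i : boundedTypes.{u} r × ℕ => (i.1 : Formula → ℝ)) = V :=
      Ultrafilter.coe_le_coe.1 hW1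
    rw [← h2]
    exact h1

end

section

open Filter Topology

/-! ### Matrix algebras as tracial W*-algebras -/

/-- The unit ball is compact, so its image under the GNS map `a ↦ aΩ` is closed; faithfulness makes
this map injective. -/
theorem IsTracialState.isTracialWStar_of_finiteDimensional {A : Type u} [CStarAlgebra A]
    [FiniteDimensional ℂ A] {σ : A →ₗ[ℂ] ℂ} (h : IsTracialState σ)
    (hf : ∀ x, σ (star x * x) = 0 → x = 0) : IsTracialWStar σ := by
  let _ := CStarAlgebra.spectralOrder A
  have := CStarAlgebra.spectralOrderedRing A
  let f := h.toPositive
  let j₀ : A →ₗ[ℂ] f.GNS :=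
    { toFun := fun a => f.gnsStarAlgHom a (gnsVector f)
      map_add' := fun a b => by rw [map_add]; rfl
      map_smul' := fun c a => by rw [map_smul]; rfl }
  let j : A →L[ℂ] f.GNS := LinearMap.toContinuousLinearMap j₀
  have hj : ∀ a, j a = f.gnsStarAlgHom a (gnsVector f) := fun a => rfl
  have hj0 : ∀ a, j a = 0 → a = 0 := fun a ha => hf a <| by
    have h1 : σ (star a * a) = f (star a * a) := rfl
    have h2 : f.gnsStarAlgHom (star a * a) (gnsVector f)
        = f.gnsStarAlgHom (star a) (j a) := by rw [map_mul]; rfl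
    rw [h1, ← inner_gnsVector, h2, ha, map_zero, inner_zero_right]
  refine h.isTracialWStar j (fun x => ?_) ((injective_iff_map_eq_zero j).2 hj0)
    (fun x hx => by rw [hf x hx, map_zero]) ?_
  · rw [hj, hj, map_one, one_apply_eq_self, inner_gnsVector]; rfl
  · have : ProperSpace A := FiniteDimensional.proper ℂ A
    exact ((isCompact_closedBall (0 : A) 1).image j.continuous).isClosed

theorem Formula.eval_starAlgEquiv {A : Type u} {B : Type v} [CStarAlgebra A] [CStarAlgebra B]
    (e : A ≃⋆ₐ[ℂ] B) {τ : A →ₗ[ℂ] ℂ} {σ : B →ₗ[ℂ] ℂ} (h : ∀ a, σ (e a) = τ a) (φ : Formula)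
    (X : ℕ → A) : φ.eval σ (fun j => e (X j)) = φ.eval τ X := by
  have ht : ∀ (t : Term) (X : ℕ → A), t.eval (fun j => e (X j)) = e (t.eval X) :=
    fun t X => t.eval_map (e : A →⋆ₐ[ℂ] B) X
  induction φ generalizing X with
  | reTr t => simp only [Formula.eval, ht, h]
  | imTr t => simp only [Formula.eval, ht, h]
  | dist s t => simp only [Formula.eval, ht, norm2, ← map_sub, ← map_star, ← map_mul, h]
  | conn n F φ ih => simp only [Formula.eval, ih]
  | inf r j φ ih =>
    simp only [Formula.eval]
    refine ((e.toEquiv.subtypeEquiv fun a => ?_).iInf_congr fun Y => ?_).symm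
    · rw [show e.toEquiv a = e a from rfl, StarAlgEquiv.norm_map]
    · rw [← ih, update_map]; rfl
  | sup r j φ ih =>
    simp only [Formula.eval]
    refine ((e.toEquiv.subtypeEquiv fun a => ?_).iSup_congr fun Y => ?_).symm
    · rw [show e.toEquiv a = e a from rfl, StarAlgEquiv.norm_map]
    · rw [← ih, update_map]; rfl

section Matrix

open scoped Matrix.Norms.L2Operator ComplexOrder

/-- The normalized trace on matrices over an arbitrary finite index type. -/
noncomputable def normalizedTrace (m : Type*) [Fintype m] : Matrix m m ℂ →ₗ[ℂ] ℂ :=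
  (Fintype.card m : ℂ)⁻¹ • Matrix.traceLinearMap m ℂ ℂ

theorem normalizedTrace_apply {m : Type*} [Fintype m] (x : Matrix m m ℂ) :
    normalizedTrace m x = (Fintype.card m : ℂ)⁻¹ * x.trace := rfl

theorem isTracialWStar_normalizedTrace (m : Type u) [Fintype m] [DecidableEq m] [Nonempty m] :
    IsTracialWStar (normalizedTrace m) := by
  have hc : (Fintype.card m : ℂ)⁻¹ ≠ 0 := inv_ne_zero (by exact_mod_cast Fintype.card_ne_zero)
  have hp : ∀ x : Matrix m m ℂ, 0 ≤ normalizedTrace m (star x * x) := fun x => by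
    rw [normalizedTrace_apply]
    refine mul_nonneg ?_ (Matrix.posSemidef_conjTranspose_mul_self x).trace_nonneg
    rw [← Complex.ofReal_natCast, ← Complex.ofReal_inv, Complex.zero_le_real]
    positivity
  refine IsTracialState.isTracialWStar_of_finiteDimensional
    ⟨fun x => (Complex.nonneg_iff.1 (hp x)).1, fun x => (Complex.nonneg_iff.1 (hp x)).2.symm, ?_,
      fun x y => ?_⟩ fun x hx => ?_
  · rw [normalizedTrace_apply, Matrix.trace_one, inv_mul_cancel₀ (by simp)]
  · rw [normalizedTrace_apply, normalizedTrace_apply, Matrix.trace_mul_comm]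
  · rw [normalizedTrace_apply] at hx
    exact Matrix.trace_conjTranspose_mul_self_eq_zero_iff.1 ((mul_eq_zero.1 hx).resolve_left hc)

/-- Brings microstates under the compactness theorem. Types are realized in `Type u`, so the
matrices are reindexed by `ULift`; `n = 0` is excluded because its trace is zero, not a state. -/
theorem tp_trN_mem_boundedTypes {n : ℕ} (hn : n ≠ 0) {r : Radii}
    {X : ℕ → Matrix (Fin n) (Fin n) ℂ} (hX : ∀ j, ‖X j‖ ≤ r j) :
    tp (trN n) X ∈ boundedTypes.{u} r := by
  have : NeZero n := ⟨hn⟩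
  let e : Matrix (Fin n) (Fin n) ℂ ≃⋆ₐ[ℂ] Matrix (ULift.{u} (Fin n)) (ULift.{u} (Fin n)) ℂ :=
    StarAlgEquiv.ofAlgEquiv (Matrix.reindexAlgEquiv ℂ ℂ Equiv.ulift.symm) fun x => rfl
  have he : ∀ a, normalizedTrace (ULift.{u} (Fin n)) (e a) = trN n a := fun a => by
    have h1 : Matrix.trace (e a) = Matrix.trace a :=
      Equiv.sum_comp (Equiv.ulift : ULift.{u} (Fin n) ≃ Fin n) fun i => a i i
    rw [normalizedTrace_apply, h1, Fintype.card_ulift, Fintype.card_fin]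
    rfl
  refine ⟨_, inferInstance, normalizedTrace (ULift.{u} (Fin n)), fun j => e (X j),
    isTracialWStar_normalizedTrace _, fun j => ?_, funext fun φ => φ.eval_starAlgEquiv e he X⟩
  rw [StarAlgEquiv.norm_map]
  exact hX j

end Matrix

end

section

open Filter Topology

/-! ### Orbital covering numbers -/

section Covering

open scoped Matrix.Norms.L2Operator

theorem orbCov_mono {n : ℕ} {F : Finset ℕ} {ε : ℝ} {A B : Set (ℕ → Matrix (Fin n) (Fin n) ℂ)}
    (h : A ⊆ B) : orbCov F ε A ≤ orbCov F ε B :=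
  iInf₂_mono' fun S hS => ⟨S, h.trans hS, le_rfl⟩

theorem orbNhd_mono {n : ℕ} {F : Finset ℕ} {ε : ℝ} {A B : Set (ℕ → Matrix (Fin n) (Fin n) ℂ)}
    (h : A ⊆ B) : orbNhd F ε A ⊆ orbNhd F ε B :=
  fun _ ⟨V, hV, X, hX, hY⟩ => ⟨V, hV, X, h hX, hY⟩

theorem subset_orbNhd {n : ℕ} {F : Finset ℕ} {ε : ℝ} (hε : 0 < ε)
    (A : Set (ℕ → Matrix (Fin n) (Fin n) ℂ)) : A ⊆ orbNhd F ε A :=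
  fun X hX => ⟨1, one_mem _, X, hX, fun i _ => by simpa [norm2] using hε⟩

/-- The infimum is attained because `ℕ∞` is well-ordered and `A` covers itself. -/
theorem exists_encard_eq_orbCov {n : ℕ} {F : Finset ℕ} {ε : ℝ} (hε : 0 < ε)
    (A : Set (ℕ → Matrix (Fin n) (Fin n) ℂ)) :
    ∃ S, A ⊆ orbNhd F ε S ∧ S.encard = orbCov F ε A := by
  have : Nonempty {S // A ⊆ orbNhd F ε S} := ⟨⟨A, subset_orbNhd hε A⟩⟩
  obtain ⟨S, hS⟩ := ciInf_mem fun S : {S // A ⊆ orbNhd F ε S} => S.1.encard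
  exact ⟨S.1, S.2, hS.trans (iInf_subtype' (f := fun S (_ : A ⊆ orbNhd F ε S) => S.encard)).symm⟩

theorem orbCov_union_le {n : ℕ} {F : Finset ℕ} {ε : ℝ} (hε : 0 < ε)
    (A B : Set (ℕ → Matrix (Fin n) (Fin n) ℂ)) :
    orbCov F ε (A ∪ B) ≤ orbCov F ε A + orbCov F ε B := by
  obtain ⟨S, hS, hS'⟩ := exists_encard_eq_orbCov (F := F) hε A
  obtain ⟨T, hT, hT'⟩ := exists_encard_eq_orbCov (F := F) hε B
  rw [← hS', ← hT']
  refine le_trans (iInf₂_le (S ∪ T) ?_) (Set.encard_union_le S T)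
  exact Set.union_subset (hS.trans (orbNhd_mono Set.subset_union_left))
    (hT.trans (orbNhd_mono Set.subset_union_right))

theorem orbCov_empty {n : ℕ} (F : Finset ℕ) (ε : ℝ) :
    orbCov F ε (∅ : Set (ℕ → Matrix (Fin n) (Fin n) ℂ)) = 0 :=
  le_antisymm (iInf₂_le_of_le ∅ (Set.empty_subset _) (Set.encard_empty).le) bot_le

/-- From `a + b ≤ 2 max(a, b)`. With `c = 1/n²` the additive error vanishes in the limit. -/
theorem mul_log_le_of_le_add {c : ℝ} (hc : 0 ≤ c) {K a b : ENNReal} (h : K ≤ a + b) :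
    (c : EReal) * ENNReal.log K ≤
      ((c * Real.log 2 : ℝ) : EReal) + max (c * ENNReal.log a) (c * ENNReal.log b) := by
  have hc' : (0 : EReal) ≤ c := by exact_mod_cast hc
  have h2 : ENNReal.log 2 = Real.log 2 := by
    have := ENNReal.log_ofReal_of_pos (x := 2) two_pos
    simpa using this
  have key : ∀ d : ENNReal, K ≤ 2 * d → (c : EReal) * ENNReal.log K ≤
      ((c * Real.log 2 : ℝ) : EReal) + c * ENNReal.log d := fun d hd => by
    have h3 : ENNReal.log K ≤ Real.log 2 + ENNReal.log d := by
      rw [← h2, ← ENNReal.log_mul_add]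
      exact ENNReal.log_le_log hd
    rw [EReal.coe_mul, ← EReal.left_distrib_of_nonneg_of_ne_top hc' (EReal.coe_ne_top c)]
    exact mul_le_mul_of_nonneg_left h3 hc'
  rcases le_total a b with hab | hab
  · refine (key b (h.trans ?_)).trans (add_le_add le_rfl (le_max_right _ _))
    rw [two_mul]; gcongr
  · refine (key a (h.trans ?_)).trans (add_le_add le_rfl (le_max_left _ _))
    rw [two_mul]; gcongr

variable {U : Ultrafilter ℕ}

/-- Compactness of `EReal` makes the limit in `covRate` a genuine one. -/
theorem tendsto_covRate (U : Ultrafilter ℕ) (F : Finset ℕ) (ε : ℝ)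
    (Γ : (n : ℕ) → Set (ℕ → Matrix (Fin n) (Fin n) ℂ)) :
    Tendsto (fun n : ℕ => ((1 / (n : ℝ) ^ 2 : ℝ) : EReal) * ENNReal.log (orbCov F ε (Γ n) : ENNReal))
      U (𝓝 (covRate U F ε Γ)) := by
  refine tendsto_nhds_limUnder ?_
  obtain ⟨z, -, hz⟩ := isCompact_univ.ultrafilter_le_nhds
    (U.map fun n : ℕ => ((1 / (n : ℝ) ^ 2 : ℝ) : EReal) * ENNReal.log (orbCov F ε (Γ n) : ENNReal))
    (by simp)
  exact ⟨z, hz⟩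

theorem covRate_mono {F : Finset ℕ} {ε : ℝ}
    {Γ Δ : (n : ℕ) → Set (ℕ → Matrix (Fin n) (Fin n) ℂ)} (h : ∀ᶠ n in U, Γ n ⊆ Δ n) :
    covRate U F ε Γ ≤ covRate U F ε Δ := by
  refine le_of_tendsto_of_tendsto (tendsto_covRate U F ε Γ) (tendsto_covRate U F ε Δ) ?_
  filter_upwards [h] with n hn
  refine mul_le_mul_of_nonneg_left (ENNReal.log_le_log ?_) (by exact_mod_cast (by positivity))
  exact ENat.toENNReal_le.2 (orbCov_mono hn)

theorem covRate_union_le (hU : (U : Filter ℕ) ≤ atTop) {F : Finset ℕ} {ε : ℝ} (hε : 0 < ε)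
    (Γ Δ : (n : ℕ) → Set (ℕ → Matrix (Fin n) (Fin n) ℂ)) :
    covRate U F ε (fun n => Γ n ∪ Δ n) ≤ max (covRate U F ε Γ) (covRate U F ε Δ) := by
  have h1 : Tendsto (fun n : ℕ => ((1 / (n : ℝ) ^ 2 * Real.log 2 : ℝ) : EReal)) U (𝓝 0) := by
    have h2 : Tendsto (fun n : ℕ => 1 / (n : ℝ) ^ 2 * Real.log 2) U (𝓝 0) := by
      have h3 : Tendsto (fun n : ℕ => 1 / (n : ℝ) ^ 2) atTop (𝓝 0) :=
        tendsto_const_nhds.div_atTop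
          ((tendsto_pow_atTop two_ne_zero).comp tendsto_natCast_atTop_atTop)
      simpa using (h3.mul_const (Real.log 2)).mono_left hU
    exact (continuous_coe_real_ereal.tendsto 0).comp h2
  have h4 := (tendsto_covRate U F ε Γ).max (tendsto_covRate U F ε Δ)
  -- Addition on `EReal` is continuous here because the first summand is finite.
  have h5 := (EReal.continuousAt_add (p := (0, max (covRate U F ε Γ) (covRate U F ε Δ)))
    (Or.inl EReal.zero_ne_top) (Or.inl EReal.zero_ne_bot)).tendsto.comp (h1.prodMk_nhds h4)
  rw [zero_add] at h5
  refine le_of_tendsto_of_tendsto' (tendsto_covRate U F ε _) h5 fun n => ?_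
  refine mul_log_le_of_le_add (by positivity) ?_
  rw [← ENat.toENNReal_add]
  exact ENat.toENNReal_le.2 (orbCov_union_le hε _ _)

theorem covRate_empty (hU : (U : Filter ℕ) ≤ atTop) (F : Finset ℕ) (ε : ℝ) :
    covRate U F ε (fun _ => ∅) = ⊥ := by
  refine tendsto_nhds_unique (tendsto_covRate U F ε _) (tendsto_const_nhds.congr' ?_)
  -- At `n = 0` the coefficient `1 / 0 ^ 2` is zero and would not give `⊥`.
  filter_upwards [hU (eventually_ne_atTop 0)] with n hn
  rw [orbCov_empty]
  simp only [ENat.toENNReal_zero, ENNReal.log_zero]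
  rw [EReal.coe_mul_bot_of_pos (by positivity)]

theorem covRate_biUnion_le (hU : (U : Filter ℕ) ≤ atTop) {F : Finset ℕ} {ε : ℝ} (hε : 0 < ε)
    {ι : Type*} (t : Finset ι) (Γ : ι → (n : ℕ) → Set (ℕ → Matrix (Fin n) (Fin n) ℂ)) {c : EReal}
    (h : ∀ i ∈ t, covRate U F ε (Γ i) ≤ c) : covRate U F ε (fun n => ⋃ i ∈ t, Γ i n) ≤ c := by
  classical
  induction t using Finset.induction_on with
  | empty => simp [covRate_empty hU]
  | insert i t _ ih =>
    simp only [Finset.set_biUnion_insert]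
    refine (covRate_union_le hU hε _ _).trans (max_le (h i (Finset.mem_insert_self _ _)) (ih ?_))
    exact fun k hk => h k (Finset.mem_insert_of_mem hk)

end Covering

/-! ### The spaces of types -/

theorem exists_type_of_mem_boundedTypes {r : Radii} {f : Formula → ℝ}
    (hf : f ∈ boundedTypes.{u} r) : ∃ p ∈ TypeSpace.bounded.{u} r, p.toFun = f := by
  obtain ⟨M, i, τ, X, h, hX, rfl⟩ := hf
  exact ⟨⟨_, M, i, τ, X, h, rfl⟩, ⟨M, i, τ, X, h, hX, rfl⟩, rfl⟩

theorem restrict_mem_bounded {r : Radii} {p : TypeSpace.{u}} (hp : p ∈ TypeSpace.bounded r) :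
    restrict p ∈ ExistentialTypeSpace.bounded r := by
  obtain ⟨M, i, τ, X, h, hX, hp⟩ := hp
  exact ⟨M, i, τ, X, h, hX, funext fun φ => congrFun hp φ.1⟩

/-- A compact subset of a Hausdorff product is closed. This lets an open set be enlarged by all
types that are not `r`-bounded without gaining `r`-bounded microstates. -/
theorem isOpen_compl_bounded (r : Radii) : IsOpen (TypeSpace.bounded.{u} r)ᶜ :=
  (TypeSpace.isOpen_iff _).2 fun _ => ⟨(boundedTypes r)ᶜ,
    (isCompact_boundedTypes r).isClosed.isOpen_compl, fun _ _ => Iff.rfl⟩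

theorem isOpen_restrict_preimage {O : Set ExistentialTypeSpace.{u}} (hO : IsOpen O) :
    IsOpen (restrict ⁻¹' O) := by
  refine (TypeSpace.isOpen_iff _).2 fun r => ?_
  have h : ∀ p : {p : TypeSpace.{u} // p ∈ TypeSpace.bounded r ∧ restrict p ∈ O},
      ∃ W : Set (Formula → ℝ), IsOpen W ∧ p.1.toFun ∈ W ∧
        ∀ q ∈ TypeSpace.bounded r, q.toFun ∈ W → restrict q ∈ O := by
    rintro ⟨p, hp, hpO⟩
    obtain ⟨s, ε, hε, H⟩ := hO r (restrict p) hpO (restrict_mem_bounded hp)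
    refine ⟨⋂ φ ∈ s, {f | f φ.1 < p.toFun φ.1 + ε φ}, isOpen_biInter_finset fun φ _ =>
      isOpen_lt (continuous_apply _) continuous_const, ?_, fun q hq hqW => ?_⟩
    · exact Set.mem_iInter₂.2 fun φ hφ => lt_add_of_pos_right _ (hε φ hφ)
    · exact H _ (restrict_mem_bounded hq) fun φ hφ => Set.mem_iInter₂.1 hqW φ hφ
  choose W hWo hpW hW using h
  refine ⟨⋃ p, W p, isOpen_iUnion hWo, fun q hq => ⟨fun hqO => ?_, fun hqW => ?_⟩⟩
  · exact Set.mem_iUnion.2 ⟨⟨q, hq, hqO⟩, hpW _⟩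
  · obtain ⟨p, hp⟩ := Set.mem_iUnion.1 hqW
    exact hW p q hq hp

theorem ExistentialTypeSpace.exists_bounded (μ : ExistentialTypeSpace.{u}) :
    ∃ R : ℕ → ℝ, ∀ r : Radii, (∀ j, R j ≤ r j) → μ ∈ ExistentialTypeSpace.bounded r := by
  obtain ⟨M, i, τ, X, h, hX⟩ := μ.realized
  exact ⟨fun j => ‖X j‖, fun r hr => ⟨M, i, τ, X, h, hr, hX⟩⟩

/-- Basic neighbourhoods impose only upper bounds, and an extension satisfies all those that `μ`
does. The radii are taken large enough to bound both types, since openness is tested one `r` at a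
time. -/
theorem extensions_subset {O : Set ExistentialTypeSpace.{u}} (hO : IsOpen O)
    {μ : ExistentialTypeSpace.{u}} (hμ : μ ∈ O) : extensions μ ⊆ O := by
  intro ν hν
  obtain ⟨R, hR⟩ := μ.exists_bounded
  obtain ⟨S, hS⟩ := ν.exists_bounded
  let r : Radii := fun j => ⟨max (max (R j) (S j)) 1, Set.mem_Ioi.2 (lt_max_of_lt_right one_pos)⟩
  have hr : ∀ j, (r j : ℝ) = max (max (R j) (S j)) 1 := fun j => rfl
  obtain ⟨s, ε, hε, H⟩ := hO r μ hμ (hR r fun j => by rw [hr]; simp)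
  exact H ν (hS r fun j => by rw [hr]; simp) fun φ hφ =>
    (hν φ).trans_lt (lt_add_of_pos_right _ (hε φ hφ))

theorem isOpen_setOf_existential_lt (φ : ExistentialFormula) (c : ℝ) :
    IsOpen {ν : ExistentialTypeSpace.{u} | ν.toFun φ < c} := by
  intro r μ hμ _
  refine ⟨{φ}, fun _ => c - μ.toFun φ, fun _ _ => sub_pos.2 hμ, fun ν _ h => ?_⟩
  simpa using h φ (Finset.mem_singleton_self φ)

/-! ### The variational principle -/

section Entropy

open scoped Matrix.Norms.L2Operator

variable {U : Ultrafilter ℕ}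

theorem entAt_le_entExistsAt (r : Radii) (F : Finset ℕ) (ε : ℝ) (μ : ExistentialTypeSpace.{u}) :
    entAt U r F ε (restrict ⁻¹' extensions μ) ≤ entExistsAt U r F ε {μ} := by
  refine le_iInf fun O => le_iInf₂ fun hO hμ => ?_
  refine (iInf_le _ (restrict ⁻¹' O)).trans ((iInf₂_le (isOpen_restrict_preimage hO)
    (Set.preimage_mono (extensions_subset hO (hμ rfl)))).trans (covRate_mono (.of_forall ?_)))
  rintro n X ⟨hX, p, hp, hpX⟩
  exact ⟨hX, restrict p, hp, funext fun φ => congrFun hpX φ.1⟩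

/-- A type outside `O` does not restrict to an extension of `μ`, so some existential value lies
above a constant exceeding that of `μ`. These strict inequalities are open conditions, and bounded
types outside `O` form a compact set. -/
theorem exists_finset_lt_of_notMem {μ : ExistentialTypeSpace.{u}} {O : Set TypeSpace.{u}}
    (hO : IsOpen O) (hK : restrict ⁻¹' extensions μ ⊆ O) (r : Radii) :
    ∃ t : Finset {q : ExistentialFormula × ℝ // μ.toFun q.1 < q.2},
      ∀ p ∈ TypeSpace.bounded r, p ∉ O → ∃ q ∈ t, q.1.2 < p.toFun q.1.1.1 := by
  obtain ⟨V, hV, hVO⟩ := (TypeSpace.isOpen_iff O).1 hO r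
  have hcov : boundedTypes r ∩ Vᶜ ⊆ ⋃ q : {q : ExistentialFormula × ℝ // μ.toFun q.1 < q.2},
      {f : Formula → ℝ | q.1.2 < f q.1.1.1} := by
    rintro f ⟨hf, hfV⟩
    obtain ⟨p, hp, rfl⟩ := exists_type_of_mem_boundedTypes hf
    have h1 : ¬ ∀ φ, (restrict p).toFun φ ≤ μ.toFun φ := fun h => hfV ((hVO p hp).1 (hK h))
    obtain ⟨φ, hφ⟩ := not_forall.1 h1
    obtain ⟨c, hc, hc'⟩ := exists_between (not_le.1 hφ)
    exact Set.mem_iUnion.2 ⟨⟨(φ, c), hc⟩, hc'⟩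
  obtain ⟨t, ht⟩ := ((isCompact_boundedTypes r).inter_right hV.isClosed_compl).elim_finite_subcover
    _ (fun q => isOpen_lt continuous_const (continuous_apply _)) hcov
  refine ⟨t, fun p hp hpO => ?_⟩
  obtain ⟨q, hq, h⟩ := Set.mem_iUnion₂.1 (ht ⟨hp, fun h => hpO ((hVO p hp).2 h)⟩)
  exact ⟨q, hq, h⟩

/-- The finitely many inequalities, reversed, define a neighbourhood of `μ`. It depends on `r`,
which is harmless because only `r`-bounded microstates enter. -/
theorem entExistsAt_le_entAt (hU : (U : Filter ℕ) ≤ atTop) (r : Radii) (F : Finset ℕ) (ε : ℝ)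
    (μ : ExistentialTypeSpace.{u}) :
    entExistsAt U r F ε {μ} ≤ entAt U r F ε (restrict ⁻¹' extensions μ) := by
  refine le_iInf fun O => le_iInf₂ fun hO hK => ?_
  obtain ⟨t, ht⟩ := exists_finset_lt_of_notMem hO hK r
  have hopen : IsOpen (⋂ q ∈ t, {ν : ExistentialTypeSpace.{u} | ν.toFun q.1.1 < q.1.2}) :=
    isOpen_biInter_finset fun q _ => isOpen_setOf_existential_lt _ _
  have hμ : {μ} ⊆ ⋂ q ∈ t, {ν : ExistentialTypeSpace.{u} | ν.toFun q.1.1 < q.1.2} :=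
    Set.singleton_subset_iff.2 (Set.mem_iInter₂.2 fun q _ => q.2)
  refine (iInf_le _ _).trans ((iInf₂_le hopen hμ).trans (covRate_mono ?_))
  filter_upwards [hU (eventually_ne_atTop 0)] with n hn
  rintro X ⟨hX, p, hp, hpX⟩
  obtain ⟨q, hq, hqX⟩ := exists_type_of_mem_boundedTypes (tp_trN_mem_boundedTypes.{u} hn hX)
  refine ⟨hX, q, ?_, hqX⟩
  by_contra hqO
  obtain ⟨i, hi, hlt⟩ := ht q hq hqO
  have h1 : p.toFun i.1.1 < i.1.2 := Set.mem_iInter₂.1 hp i hi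
  rw [hpX] at h1
  rw [hqX] at hlt
  exact lt_asymm h1 hlt

theorem ent_mono {K L : Set TypeSpace.{u}} (h : K ⊆ L) : ent U K ≤ ent U L :=
  iSup_mono fun _ => iSup_mono fun _ => iSup₂_mono fun _ _ =>
    le_iInf fun O => le_iInf₂ fun hO hL => (iInf_le _ O).trans (iInf₂_le hO (h.trans hL))

/-- For `c` above the supremum, each bounded type of `K` has an open neighbourhood of rate below
`c`. Closedness of `L` makes the bounded part of `K` compact, so finitely many neighbourhoods
suffice, and finite unions do not raise the rate above `c`. -/
theorem entAt_le_iSup_ent (hU : (U : Filter ℕ) ≤ atTop) (r : Radii) (F : Finset ℕ) {ε : ℝ}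
    (hε : 0 < ε) {K : Set TypeSpace.{u}} {L : Set (Formula → ℝ)} (hL : IsClosed L)
    (hKL : ∀ p, p ∈ K ↔ p.toFun ∈ L) : entAt U r F ε K ≤ ⨆ ν ∈ K, ent U {ν} := by
  refine le_of_forall_gt_imp_ge_of_dense fun c hc => ?_
  have h1 : ∀ p : {p // p ∈ TypeSpace.bounded r ∧ p ∈ K}, ∃ O : Set TypeSpace.{u}, IsOpen O ∧
      p.1 ∈ O ∧ covRate U F ε (fun n => microstates r n O) < c := fun p => by
    have h2 : entAt U r F ε {p.1} < c :=
      lt_of_le_of_lt (le_iSup₂_of_le (f := fun ν (_ : ν ∈ K) => ent U {ν}) p.1 p.2.2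
        (le_iSup_of_le r (le_iSup_of_le F (le_iSup₂_of_le ε hε le_rfl)))) hc
    obtain ⟨O, h3⟩ := iInf_lt_iff.1 h2
    obtain ⟨hO, h4⟩ := iInf_lt_iff.1 h3
    obtain ⟨hp, h5⟩ := iInf_lt_iff.1 h4
    exact ⟨O, hO, hp rfl, h5⟩
  choose O hO hpO hOc using h1
  choose V hV hVO using fun p => (TypeSpace.isOpen_iff (O p)).1 (hO p) r
  have hcov : boundedTypes r ∩ L ⊆ ⋃ p, V p := by
    rintro f ⟨hf, hfL⟩
    obtain ⟨p, hp, rfl⟩ := exists_type_of_mem_boundedTypes hf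
    exact Set.mem_iUnion.2 ⟨⟨p, hp, (hKL p).2 hfL⟩, (hVO _ p hp).1 (hpO _)⟩
  obtain ⟨t, ht⟩ := ((isCompact_boundedTypes r).inter_right hL).elim_finite_subcover V hV hcov
  -- The finite cover reaches only the bounded part of `K`; the complement accounts for the rest and
  -- contributes no microstates for `n ≠ 0`.
  have hopen : IsOpen ((⋃ p ∈ t, O p) ∪ (TypeSpace.bounded r)ᶜ) :=
    (isOpen_biUnion fun p _ => hO p).union (isOpen_compl_bounded r)
  have hsub : K ⊆ (⋃ p ∈ t, O p) ∪ (TypeSpace.bounded r)ᶜ := by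
    intro q hqK
    by_cases hq : q ∈ TypeSpace.bounded r
    · obtain ⟨p, hp, hqp⟩ := Set.mem_iUnion₂.1 (ht ⟨hq, (hKL q).1 hqK⟩)
      exact Or.inl (Set.mem_iUnion₂.2 ⟨p, hp, (hVO p q hq).2 hqp⟩)
    · exact Or.inr hq
  refine (iInf_le _ _).trans ((iInf₂_le hopen hsub).trans (le_trans (covRate_mono ?_)
    (covRate_biUnion_le hU hε t (fun p n => microstates r n (O p)) fun p _ => (hOc p).le)))
  filter_upwards [hU (eventually_ne_atTop 0)] with n hn
  rintro X ⟨hX, q, hq, hqX⟩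
  have hqr : q ∈ TypeSpace.bounded r := by
    change q.toFun ∈ boundedTypes r
    rw [hqX]
    exact tp_trN_mem_boundedTypes hn hX
  rcases hq with hq | hq
  · obtain ⟨p, hp, hqp⟩ := Set.mem_iUnion₂.1 hq
    exact Set.mem_iUnion₂.2 ⟨p, hp, hX, q, hqp, hqX⟩
  · exact absurd hqr hq

end Entropy

end

end TracialEntropy

theorem mainTheorem6 (U : Ultrafilter ℕ) (hU : ∀ n : ℕ, U ≠ pure n)
    (μ : TracialEntropy.ExistentialTypeSpace.{u}) :
    TracialEntropy.entExists U {μ} =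
        TracialEntropy.ent U (TracialEntropy.restrict ⁻¹' TracialEntropy.extensions μ) ∧
      TracialEntropy.ent U (TracialEntropy.restrict ⁻¹' TracialEntropy.extensions μ) =
        ⨆ ν ∈ TracialEntropy.restrict ⁻¹' TracialEntropy.extensions μ,
          TracialEntropy.ent U {ν} := by
  have hU' : (U : Filter ℕ) ≤ Filter.atTop := by
    rw [← Nat.cofinite_eq_atTop]
    exact U.le_cofinite_or_eq_pure.resolve_right fun ⟨n, hn⟩ => hU n hn
  refine ⟨le_antisymm ?_ ?_, le_antisymm ?_ ?_⟩
  · exact iSup_mono fun r => iSup_mono fun F => iSup₂_mono fun ε _ =>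
      TracialEntropy.entExistsAt_le_entAt hU' r F ε μ
  · exact iSup_mono fun r => iSup_mono fun F => iSup₂_mono fun ε _ =>
      TracialEntropy.entAt_le_entExistsAt r F ε μ
  · refine iSup_le fun r => iSup_le fun F => iSup₂_le fun ε hε =>
      TracialEntropy.entAt_le_iSup_ent hU' r F hε
        (L := ⋂ φ : TracialEntropy.ExistentialFormula, {f | f φ.1 ≤ μ.toFun φ}) ?_ ?_
    · exact isClosed_iInter fun φ => isClosed_le (continuous_apply _) continuous_const
    · exact fun p => by rw [Set.mem_iInter]; rfl
  · exact iSup₂_le fun ν hν => TracialEntropy.ent_mono (Set.singleton_subset_iff.2 hν)
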